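/- Consider on $\mathbb{R}_x\times\mathbb{R}_v$ the system $$\partial_t f+v\,\partial_x f+B\,\partial_v f=0,\qquad \partial_tB+\partial_xB=\int_{\mathbb{R}} f\,dv,\qquad f(0,x,v)=f_0(x,v),\quad B(0,x)=B_0(x),\tag{$*$}$$ for $f=f(t,x,v)$ and $B=B(t,x)$. For $T>0$, a classical solution of $(*)$ on $[0,T]$ is a pair of real functions $f\in C^1([0,T]\times\mathbb{R}^2)$, $B\in C^1([0,T]\times\mathbb{R})$ satisfying $(*)$ for all $t\in[0,T]$ (with one-sided time derivatives at the endpoints), such that the functions $f(t,\cdot,\cdot)$, $t\in[0,T]$, all vanish outside one compact subset of $\mathbb{R}^2$. Let $T^*\in[0,\infty]$ be the supremum of all $T>0$ for which a classical solution on $[0,T]$ exists. **Theorem (Existence of classical solutions).** Let $f_0\in C^1_c(\mathbb{R}^2)$ and $B_0\in C^1(\mathbb{R})$. Then there is $T>0$ such that $(*)$ has a classical solution on $[0,T]$; for every $T>0$ there is at most one classical solution on $[0,T]$; and consequently there is a pair $(f,B)$, unique on $[0,T^*)$, whose restriction to $[0,T]$ is a classical solution for every $0<T<T^*$. Moreover,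 if $B_0$ is bounded and $T^*<\infty$, then this solution satisfies $$\limsup_{t\uparrow T^*}\Bigl(\|\partial_xf(t)\|_\infty+\|\partial_vf(t)\|_\infty\Bigr)=\infty .$$ -/

import Mathlib

open Set Filter Topology
open scoped ENNReal

namespace VlasovField

/-- `f` is continuously differentiable on `[0,T] × ℝ²` (up to the boundary in time) and the
functions `f t`, `t ∈ [0,T]`, are all supported in one compact set of the `(x,v)` plane. -/
def IsDensityClass (T : ℝ) (f : ℝ → ℝ → ℝ → ℝ) : Prop :=
  ContDiffOn ℝ 1 (fun p : ℝ × ℝ × ℝ => f p.1 p.2.1 p.2.2) (Icc 0 T ×ˢ univ) ∧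
  ∃ K : Set (ℝ × ℝ), IsCompact K ∧ ∀ t ∈ Icc 0 T, ∀ x v : ℝ, (x, v) ∉ K → f t x v = 0

/-- `B` is continuously differentiable on `[0,T] × ℝ` (up to the boundary in time). -/
def IsFieldClass (T : ℝ) (B : ℝ → ℝ → ℝ) : Prop :=
  ContDiffOn ℝ 1 (fun p : ℝ × ℝ => B p.1 p.2) (Icc 0 T ×ˢ univ)

/-- `(f, B)` is a classical solution on `[0,T]`, `T > 0`, of
`∂ₜ f + v ∂ₓ f + B ∂ᵥ f = 0`, `∂ₜ B + ∂ₓ B = ∫ f dv`, with `f(0) = f₀` and `B(0) = B₀`.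
Only the values of `f` and `B` at times in `[0,T]` matter; the time derivatives at `0` and `T`
are one-sided. -/
structure IsClassicalSolution (f₀ : ℝ × ℝ → ℝ) (B₀ : ℝ → ℝ) (T : ℝ)
    (f : ℝ → ℝ → ℝ → ℝ) (B : ℝ → ℝ → ℝ) : Prop where
  pos : 0 < T
  density : IsDensityClass T f
  field : IsFieldClass T B
  vlasov : ∀ t ∈ Icc 0 T, ∀ x v : ℝ,
    derivWithin (fun s => f s x v) (Icc 0 T) t + v * deriv (fun y => f t y v) x
      + B t x * deriv (fun w => f t x w) v = 0
  transport : ∀ t ∈ Icc 0 T, ∀ x : ℝ,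
    derivWithin (fun s => B s x) (Icc 0 T) t + deriv (fun y => B t y) x = ∫ v, f t x v
  init_density : ∀ x v : ℝ, f 0 x v = f₀ (x, v)
  init_field : ∀ x : ℝ, B 0 x = B₀ x

/-- The maximal lifespan: the supremum of all `T > 0` such that a classical solution with the
given data exists on `[0,T]`. -/
noncomputable def lifespan (f₀ : ℝ × ℝ → ℝ) (B₀ : ℝ → ℝ) : ℝ≥0∞ :=
  ⨆ (T : ℝ) (_ : ∃ f B, IsClassicalSolution f₀ B₀ T f B), ENNReal.ofReal T

/-- `(f, B)` is a classical solution on `[0, T*)`, with `T*` the maximal lifespan. -/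
def IsMaximalSolution (f₀ : ℝ × ℝ → ℝ) (B₀ : ℝ → ℝ)
    (f : ℝ → ℝ → ℝ → ℝ) (B : ℝ → ℝ → ℝ) : Prop :=
  ∀ T : ℝ, 0 < T → ENNReal.ofReal T < lifespan f₀ B₀ → IsClassicalSolution f₀ B₀ T f B

/-- `‖∂ₓ f(t)‖_∞ + ‖∂ᵥ f(t)‖_∞`, the suprema being taken over all `(x,v)`, in `[0,∞]`. -/
noncomputable def gradientNorm (f : ℝ → ℝ → ℝ → ℝ) (t : ℝ) : ℝ≥0∞ :=
  (⨆ (x : ℝ) (v : ℝ), ‖deriv (fun y => f t y v) x‖ₑ) +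
    ⨆ (x : ℝ) (v : ℝ), ‖deriv (fun w => f t x w) v‖ₑ

end VlasovField

/-! Given the field, the density is carried by the flow `Z` of the characteristic equations x' = v,
v' = B, so that f(t, z) = f₀(Z(0, t, z)). Given the density, integration along lines of speed one
expresses B as B₀(x - t) plus an integral of f₀ ∘ Z. Thus (Z, B) is a fixed point of an integral
map, which is a contraction in the uniform distance on a set of Lipschitz pairs when the time is
short. To have bounded data, v and B₀ are first multiplied by cut-offs. Displacements are at most 1,
so the density never sees the cut-off, and the removed part of B₀ is put back as a freely translated
wave that stays away from the density.

The contraction only gives Lipschitz functions. Rather than differentiating the fixed-point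
equation, the proof measures the failure of C¹ regularity by second differences: `AlmostC1 ε` bounds
them by ε‖h‖ on a uniform scale. Lipschitz functions satisfy it for some ε, and the fixed-point
equation turns ε into ε/2 (`IsTruncatedSolution.almostC1_half`), so every ε > 0 is reached.
Rademacher's theorem supplies a dense set of points of differentiability, and the second-difference
bounds spread differentiability to all points with a continuous derivative.

Uniqueness and the a priori bounds come from a maximum principle (`nonpos_of_max_principle`). At a
spatial maximum of f - g the transport terms cancel, and only (B - D) ∂ᵥg is left, which is
controlled by f - g through the field equation. With an exponential weight in time, any bound A
improves to c + A/2, which takes the place of Gronwall's inequality (`le_of_halving`). The same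
principle confines the support of f to moving half-planes.

For the blow-up, the local existence time depends only on the size of the support, on bounds for f
and its Lipschitz constant, and on bounds for B and ∂ₓB near the support
(`exists_solution_of_bounds`). If B₀ is bounded, the support, f and B stay bounded on bounded time
intervals. A bound for the gradient of f supplies the Lipschitz constant of f and, after integration
along lines of speed one, that of B. Restarting close enough to T* would then pass T*. -/

namespace VlasovField

/-! ### Second-difference bounds as a quantitative form of C¹ regularity -/

/-- The increments of the functions `F i` over a small step `h` at nearby points differ by at most
`ε ‖h‖`, uniformly in `i`. -/
def AlmostC1 {ι E G : Type*} [NormedAddCommGroup E] [NormedAddCommGroup G]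
    (ε : ℝ) (F : ι → E → G) : Prop :=
  ∃ r > 0, ∀ i z z' h, ‖z - z'‖ ≤ r → ‖h‖ ≤ r →
    ‖F i (z + h) - F i z - (F i (z' + h) - F i z')‖ ≤ ε * ‖h‖

section AlmostC1

variable {ι κ E E' G : Type*} [NormedAddCommGroup E] [NormedAddCommGroup E']
  [NormedAddCommGroup G]

theorem AlmostC1.of_lipschitz {F : ι → E → G} {L : ℝ}
    (hF : ∀ i z z', ‖F i z - F i z'‖ ≤ L * ‖z - z'‖) : AlmostC1 (2 * L) F := by
  refine ⟨1, one_pos, fun i z z' h _ _ => ?_⟩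
  have h1 := hF i (z + h) z
  have h2 := hF i (z' + h) z'
  rw [add_sub_cancel_left] at h1 h2
  calc _ ≤ ‖F i (z + h) - F i z‖ + ‖F i (z' + h) - F i z'‖ := norm_sub_le _ _
    _ ≤ _ := by linarith

theorem AlmostC1.mono {F : ι → E → G} {ε ε' : ℝ} (h : AlmostC1 ε F) (hε : ε ≤ ε') :
    AlmostC1 ε' F := by
  obtain ⟨r, hr, H⟩ := h
  exact ⟨r, hr, fun i z z' h h1 h2 => (H i z z' h h1 h2).trans (by gcongr)⟩

theorem AlmostC1.add {F F' : ι → E → G} {ε ε' : ℝ} (h : AlmostC1 ε F) (h' : AlmostC1 ε' F') :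
    AlmostC1 (ε + ε') (fun i z => F i z + F' i z) := by
  obtain ⟨r, hr, H⟩ := h
  obtain ⟨r', hr', H'⟩ := h'
  refine ⟨min r r', lt_min hr hr', fun i z z' h h1 h2 => ?_⟩
  have a := H i z z' h (h1.trans (min_le_left _ _)) (h2.trans (min_le_left _ _))
  have b := H' i z z' h (h1.trans (min_le_right _ _)) (h2.trans (min_le_right _ _))
  calc _ = ‖(F i (z + h) - F i z - (F i (z' + h) - F i z'))
          + (F' i (z + h) - F' i z - (F' i (z' + h) - F' i z'))‖ := by congr 1; dsimp only; abel
    _ ≤ _ := (norm_add_le _ _).trans (by linarith)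

theorem AlmostC1.reindex {F : ι → E → G} {ε : ℝ} (h : AlmostC1 ε F) (e : κ → ι) :
    AlmostC1 ε (fun k => F (e k)) := by
  obtain ⟨r, hr, H⟩ := h
  exact ⟨r, hr, fun k => H (e k)⟩

theorem AlmostC1.comp_affine {F : ι → E → G} {ε : ℝ} (h : AlmostC1 ε F) (hε : 0 ≤ ε)
    (e : κ → ι) (g : κ → E' → E) (A : E' → E) (hA : ∀ x, ‖A x‖ ≤ ‖x‖)
    (hg : ∀ k x y, g k (x + y) = g k x + A y) :
    AlmostC1 ε (fun k x => F (e k) (g k x)) := by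
  obtain ⟨r, hr, H⟩ := h
  refine ⟨r, hr, fun k z z' h h1 h2 => ?_⟩
  have hz : g k z - g k z' = A (z - z') := by
    have := hg k z' (z - z')
    rw [add_sub_cancel] at this
    rw [this]; abel
  have := H (e k) (g k z) (g k z') (A h) (by rw [hz]; exact (hA _).trans h1) ((hA _).trans h2)
  simp only [hg]
  exact this.trans (by gcongr; exact hA h)

theorem AlmostC1.prodMk {G' : Type*} [NormedAddCommGroup G'] {F : ι → E → G} {F' : ι → E → G'}
    {ε : ℝ} (h : AlmostC1 ε F) (h' : AlmostC1 ε F') : AlmostC1 ε (fun i z => (F i z, F' i z)) := by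
  obtain ⟨r, hr, H⟩ := h
  obtain ⟨r', hr', H'⟩ := h'
  refine ⟨min r r', lt_min hr hr', fun i z z' h h1 h2 => norm_prod_le_iff.2 ⟨?_, ?_⟩⟩
  · exact H i z z' h (h1.trans (min_le_left _ _)) (h2.trans (min_le_left _ _))
  · exact H' i z z' h (h1.trans (min_le_right _ _)) (h2.trans (min_le_right _ _))

/-- F is compared at two base points with the same step Z(z + h) - Z(z), which costs ε · 2‖h‖.
Replacing that step by Z(z' + h) - Z(z') is an error equal to the second difference of Z, and the
Lipschitz constant K multiplies it. -/
theorem AlmostC1.comp {F : ι → E → G} {Z : κ → E' → E} {ε ε' K : ℝ} (hF : AlmostC1 ε F)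
    (hK : ∀ i z z', ‖F i z - F i z'‖ ≤ K * ‖z - z'‖) (hK0 : 0 ≤ K) (hε : 0 ≤ ε)
    (hZ : AlmostC1 ε' Z) (hZ2 : ∀ k z z', ‖Z k z - Z k z'‖ ≤ 2 * ‖z - z'‖) (e : κ → ι) :
    AlmostC1 (2 * ε + K * ε') (fun k z => F (e k) (Z k z)) := by
  obtain ⟨r, hr, H⟩ := hF
  obtain ⟨r', hr', H'⟩ := hZ
  refine ⟨min (r / 2) r', lt_min (by positivity) hr', fun k z z' h h1 h2 => ?_⟩
  have h1a := h1.trans (min_le_left _ _)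
  have h2a := h2.trans (min_le_left _ _)
  have hk := hZ2 k (z + h) z
  rw [add_sub_cancel_left] at hk
  have a := H (e k) (Z k z) (Z k z') (Z k (z + h) - Z k z) ((hZ2 k z z').trans (by linarith))
    (hk.trans (by linarith))
  have b := H' k z z' h (h1.trans (min_le_right _ _)) (h2.trans (min_le_right _ _))
  have d := hK (e k) (Z k z' + (Z k (z + h) - Z k z)) (Z k (z' + h))
  rw [add_sub_cancel] at a
  have d' : ‖Z k z' + (Z k (z + h) - Z k z) - Z k (z' + h)‖ ≤ ε' * ‖h‖ := by
    convert b using 2; abel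
  calc _ = ‖(F (e k) (Z k (z + h)) - F (e k) (Z k z)
          - (F (e k) (Z k z' + (Z k (z + h) - Z k z)) - F (e k) (Z k z')))
          + (F (e k) (Z k z' + (Z k (z + h) - Z k z)) - F (e k) (Z k (z' + h)))‖ := by
        congr 1; abel
    _ ≤ ε * ‖Z k (z + h) - Z k z‖ + K * ‖Z k z' + (Z k (z + h) - Z k z) - Z k (z' + h)‖ :=
        (norm_add_le _ _).trans (add_le_add a d)
    _ ≤ ε * (2 * ‖h‖) + K * (ε' * ‖h‖) := by gcongr
    _ = _ := by ring

theorem AlmostC1.integral [NormedSpace ℝ G] {H : κ → ℝ → E → G} {ε l : ℝ}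
    (hε : 0 ≤ ε)
    (h : AlmostC1 ε (fun (p : κ × ℝ) z => H p.1 p.2 z))
    (hc : ∀ k z, Continuous fun τ => H k τ z) (a b : κ → ℝ) (hl : ∀ k, |b k - a k| ≤ l) :
    AlmostC1 (l * ε) (fun k z => ∫ τ in a k..b k, H k τ z) := by
  obtain ⟨r, hr, H'⟩ := h
  refine ⟨r, hr, fun k z z' h h1 h2 => ?_⟩
  have hi : ∀ z, IntervalIntegrable (fun τ => H k τ z) MeasureTheory.volume (a k) (b k) :=
    fun z => (hc k z).intervalIntegrable _ _
  simp only
  rw [← intervalIntegral.integral_sub (hi _) (hi _), ← intervalIntegral.integral_sub (hi _) (hi _),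
    ← intervalIntegral.integral_sub ((hi _).sub (hi _)) ((hi _).sub (hi _))]
  refine (intervalIntegral.norm_integral_le_of_norm_le_const
    (fun τ _ => H' (k, τ) z z' h h1 h2)).trans ?_
  have := hl k
  calc _ ≤ ε * ‖h‖ * l := by gcongr
    _ = _ := by ring

/-- The derivative is uniformly continuous, and the mean value inequality applies to y ↦ F(z + y) -
F(z' + y). -/
theorem almostC1_of_hasCompactSupport [NormedSpace ℝ E] [NormedSpace ℝ G]
    {F : E → G} (hF : ContDiff ℝ 1 F)
    (hc : HasCompactSupport F) {ε : ℝ} (hε : 0 < ε) : AlmostC1 ε (fun _ : Unit => F) := by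
  have huc : UniformContinuous (fderiv ℝ F) :=
    (hc.fderiv ℝ).uniformContinuous_of_continuous (hF.continuous_fderiv one_ne_zero)
  obtain ⟨r, hr, H⟩ := Metric.uniformContinuous_iff.1 huc ε hε
  refine ⟨r / 2, by positivity, fun _ z z' h h1 h2 => ?_⟩
  have hd := hF.differentiable one_ne_zero
  have key : ∀ y ∈ (univ : Set E), HasFDerivWithinAt (fun y => F (z + y) - F (z' + y))
      (fderiv ℝ F (z + y) - fderiv ℝ F (z' + y)) univ y := by
    intro y _
    have a1 := (hd (z + y)).hasFDerivAt.comp y ((hasFDerivAt_id y).const_add z)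
    have a2 := (hd (z' + y)).hasFDerivAt.comp y ((hasFDerivAt_id y).const_add z')
    exact (a1.sub a2).hasFDerivWithinAt
  have hb : ∀ y ∈ (univ : Set E), ‖fderiv ℝ F (z + y) - fderiv ℝ F (z' + y)‖ ≤ ε := by
    intro y _
    rw [← dist_eq_norm]
    refine (H ?_).le
    rw [dist_eq_norm, add_sub_add_right_eq_sub]
    linarith
  have := convex_univ.norm_image_sub_le_of_norm_hasFDerivWithin_le key hb (mem_univ (0 : E))
    (mem_univ h)
  simp only [add_zero, sub_zero] at this
  convert this using 2
  abel

/-- Two linear maps that approximate F at z up to ε and ε' differ by at most ε + ε' in norm.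
Approximations of accuracy 1/(n+1) therefore form a Cauchy sequence, and its limit is the
derivative. -/
theorem differentiableAt_of_almost_linear [NormedSpace ℝ E] [NormedSpace ℝ G] [CompleteSpace G]
    {F : E → G} {z : E}
    (H : ∀ ε > 0, ∃ A : E →L[ℝ] G, ∀ᶠ h in 𝓝 (0 : E), ‖F (z + h) - F z - A h‖ ≤ ε * ‖h‖) :
    DifferentiableAt ℝ F z := by
  have h0 : ∀ n : ℕ, (0 : ℝ) < 1 / (n + 1) := fun n => Nat.one_div_pos_of_nat
  choose A hA using fun n : ℕ => H (1 / (n + 1)) (h0 n)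
  have hAA : ∀ n m, ‖A n - A m‖ ≤ 1 / (n + 1) + 1 / (m + 1) := by
    intro n m
    refine ContinuousLinearMap.opNorm_le_of_nhds_zero (by have := h0 n; have := h0 m; linarith) ?_
    filter_upwards [hA n, hA m] with h h1 h2
    calc ‖(A n - A m) h‖ = ‖(F (z + h) - F z - A m h) - (F (z + h) - F z - A n h)‖ := by
          rw [sub_apply]; congr 1; abel
      _ ≤ _ := (norm_sub_le _ _).trans (by linarith)
  have hlim := tendsto_one_div_add_atTop_nhds_zero_nat (𝕜 := ℝ)
  have hC : CauchySeq A := by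
    refine cauchySeq_of_le_tendsto_0 (fun n => 2 * (1 / ((n : ℝ) + 1))) (fun n m N hn hm => ?_)
      (by simpa using hlim.const_mul 2)
    rw [dist_eq_norm]
    have h1 := Nat.one_div_le_one_div (α := ℝ) hn
    have h2 := Nat.one_div_le_one_div (α := ℝ) hm
    have := hAA n m
    linarith
  obtain ⟨A', hA'⟩ := cauchySeq_tendsto_of_complete hC
  have hle : ∀ n, ‖A n - A'‖ ≤ 1 / (n + 1) := by
    intro n
    have t1 := (tendsto_const_nhds (x := A n)).sub hA'
    have t2 : Tendsto (fun m : ℕ => 1 / ((n : ℝ) + 1) + 1 / ((m : ℝ) + 1)) atTop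
        (𝓝 (1 / ((n : ℝ) + 1) + 0)) := tendsto_const_nhds.add hlim
    rw [add_zero] at t2
    exact le_of_tendsto_of_tendsto' t1.norm t2 (hAA n)
  refine HasFDerivAt.differentiableAt (f' := A') ?_
  rw [hasFDerivAt_iff_isLittleO_nhds_zero, Asymptotics.isLittleO_iff]
  intro ε hε
  obtain ⟨n, hn⟩ := ((hlim.eventually (gt_mem_nhds (half_pos hε)))).exists
  filter_upwards [hA n] with h hh
  calc ‖F (z + h) - F z - A' h‖ = ‖(F (z + h) - F z - A n h) + (A n - A') h‖ := by
        rw [sub_apply]; congr 1; abel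
    _ ≤ 1 / (n + 1) * ‖h‖ + ‖A n - A'‖ * ‖h‖ :=
        (norm_add_le _ _).trans (add_le_add hh ((A n - A').le_opNorm h))
    _ ≤ ε / 2 * ‖h‖ + ε / 2 * ‖h‖ := by
        have := hle n
        gcongr
        linarith
    _ = _ := by ring

variable [NormedSpace ℝ E] [NormedSpace ℝ G]

/-- By Rademacher's theorem there are points z₀ of differentiability arbitrarily close to z. The
increments of F at z and z₀ are almost equal, so the derivative at z₀ is an almost linear
approximation at z. -/
theorem AlmostC1.differentiable [FiniteDimensional ℝ E] [FiniteDimensional ℝ G]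
    {F : ι → E → G} {L : NNReal} (hL : ∀ i, LipschitzWith L (F i))
    (H : ∀ ε > 0, AlmostC1 ε F) (i : ι) : Differentiable ℝ (F i) := by
  have : CompleteSpace G := FiniteDimensional.complete ℝ G
  intro z
  refine differentiableAt_of_almost_linear fun ε hε => ?_
  obtain ⟨r, hr, hF⟩ := H (ε / 2) (half_pos hε)
  borelize E
  have hd : Dense {x | DifferentiableAt ℝ (F i) x} :=
    MeasureTheory.Measure.dense_of_ae ((hL i).ae_differentiableAt (μ := MeasureTheory.Measure.addHaar))
  obtain ⟨z₀, hz₀, hzr⟩ := hd.exists_dist_lt z hr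
  refine ⟨fderiv ℝ (F i) z₀, ?_⟩
  have h1 := (hasFDerivAt_iff_isLittleO_nhds_zero.1 (DifferentiableAt.hasFDerivAt hz₀)).def
    (half_pos hε)
  filter_upwards [h1, Metric.closedBall_mem_nhds (0 : E) hr] with h h2 h3
  rw [mem_closedBall_zero_iff] at h3
  have h4 := hF i z z₀ h (by rw [← dist_eq_norm]; exact hzr.le) h3
  calc _ = ‖(F i (z + h) - F i z - (F i (z₀ + h) - F i z₀))
        + (F i (z₀ + h) - F i z₀ - fderiv ℝ (F i) z₀ h)‖ := by congr 1; abel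
    _ ≤ _ := (norm_add_le _ _).trans (by linarith)

theorem AlmostC1.norm_fderiv_sub_le {F : ι → E → G} {ε : ℝ} (hε : 0 ≤ ε) (H : AlmostC1 ε F)
    (hd : ∀ i, Differentiable ℝ (F i)) :
    ∃ r > 0, ∀ i z z', ‖z - z'‖ ≤ r → ‖fderiv ℝ (F i) z - fderiv ℝ (F i) z'‖ ≤ ε := by
  obtain ⟨r, hr, hF⟩ := H
  refine ⟨r, hr, fun i z z' hz => ?_⟩
  have a1 : HasFDerivAt (fun y => F i (z + y)) (fderiv ℝ (F i) z) 0 := by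
    have h0 : HasFDerivAt (F i) (fderiv ℝ (F i) z) (z + 0) := by
      rw [add_zero]; exact (hd i z).hasFDerivAt
    exact h0.comp (0 : E) ((hasFDerivAt_id (0 : E)).const_add z)
  have a2 : HasFDerivAt (fun y => F i (z' + y)) (fderiv ℝ (F i) z') 0 := by
    have h0 : HasFDerivAt (F i) (fderiv ℝ (F i) z') (z' + 0) := by
      rw [add_zero]; exact (hd i z').hasFDerivAt
    exact h0.comp (0 : E) ((hasFDerivAt_id (0 : E)).const_add z')
  refine (a1.sub a2).le_of_lip' hε ?_
  filter_upwards [Metric.closedBall_mem_nhds (0 : E) hr] with h h3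
  rw [mem_closedBall_zero_iff] at h3
  have := hF i z z' h hz h3
  simp only [Pi.sub_apply, add_zero, sub_zero]
  convert this using 2
  abel

/-- The difference quotients are jointly continuous in the index and the point. They converge to the
derivative uniformly, because the oscillation of the derivative on a small scale is bounded
uniformly in the index. -/
theorem AlmostC1.continuous_fderiv_apply [TopologicalSpace ι] {F : ι → E → G}
    (H : ∀ ε > 0, AlmostC1 ε F) (hd : ∀ i, Differentiable ℝ (F i))
    (hc : Continuous fun p : ι × E => F p.1 p.2) (h : E) :
    Continuous fun p : ι × E => fderiv ℝ (F p.1) p.2 h := by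
  have hu : TendstoUniformly
      (fun (n : ℕ) (p : ι × E) => ((n : ℝ) + 1) • (F p.1 (p.2 + (1 / ((n : ℝ) + 1)) • h) - F p.1 p.2))
      (fun p => fderiv ℝ (F p.1) p.2 h) atTop := by
    rw [Metric.tendstoUniformly_iff]
    intro ε hε
    have hε' : 0 < ε / (2 * (‖h‖ + 1)) := by positivity
    obtain ⟨r, hr, hF⟩ := (H _ hε').norm_fderiv_sub_le hε'.le hd
    have hlim : Tendsto (fun n : ℕ => 1 / ((n : ℝ) + 1) * ‖h‖) atTop (𝓝 (0 * ‖h‖)) :=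
      (tendsto_one_div_add_atTop_nhds_zero_nat (𝕜 := ℝ)).mul_const _
    rw [zero_mul] at hlim
    filter_upwards [hlim.eventually (gt_mem_nhds hr)] with n hn p
    have hn0 : (0 : ℝ) < n + 1 := by positivity
    have key := (convex_closedBall p.2 r).norm_image_sub_le_of_norm_fderiv_le'
      (f := F p.1) (φ := fderiv ℝ (F p.1) p.2) (C := ε / (2 * (‖h‖ + 1)))
      (x := p.2) (y := p.2 + (1 / ((n : ℝ) + 1)) • h)
      (fun x _ => hd p.1 x)
      (fun x hx => hF p.1 x p.2 (by rw [← dist_eq_norm]; exact hx))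
      (Metric.mem_closedBall_self hr.le)
      (by
        rw [Metric.mem_closedBall, dist_eq_norm, add_sub_cancel_left, norm_smul, Real.norm_eq_abs,
          abs_of_pos (by positivity)]
        exact hn.le)
    rw [add_sub_cancel_left, norm_smul, Real.norm_eq_abs, abs_of_pos (by positivity : 0 < 1 / ((n : ℝ) + 1)),
      map_smul] at key
    rw [dist_comm, dist_eq_norm]
    calc _ = ‖((n : ℝ) + 1) • (F p.1 (p.2 + (1 / ((n : ℝ) + 1)) • h) - F p.1 p.2
            - (1 / ((n : ℝ) + 1)) • fderiv ℝ (F p.1) p.2 h)‖ := by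
          rw [smul_sub _ _ ((1 / ((n : ℝ) + 1)) • _), smul_smul, mul_one_div_cancel hn0.ne', one_smul]
      _ ≤ ((n : ℝ) + 1) * (ε / (2 * (‖h‖ + 1)) * (1 / ((n : ℝ) + 1) * ‖h‖)) := by
          rw [norm_smul, Real.norm_eq_abs, abs_of_pos hn0]
          gcongr
      _ = ε / (2 * (‖h‖ + 1)) * ‖h‖ := by field_simp
      _ ≤ ε / (2 * (‖h‖ + 1)) * (‖h‖ + 1) := by gcongr; linarith
      _ = ε / 2 := by field_simp
      _ < ε := half_lt_self hε
  refine hu.continuous (Frequently.of_forall fun n => ?_)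
  have c1 : Continuous fun p : ι × E => F p.1 (p.2 + (1 / ((n : ℝ) + 1)) • h) :=
    hc.comp (continuous_fst.prodMk (continuous_snd.add continuous_const))
  exact (c1.sub hc).const_smul _

end AlmostC1

/-! ### Comparison principles -/

/-- The least admissible A is the supremum A* (or 0), and it satisfies A* ≤ c + A*/2. Finiteness of
the supremum is essential for absorbing the last term. Applied to time-weighted quantities, this
replaces Gronwall's inequality. -/
theorem le_of_halving {ι : Type*} {u : ι → ℝ} {c : ℝ} (hc : 0 ≤ c) (hb : BddAbove (range u))
    (step : ∀ A, 0 ≤ A → (∀ i, u i ≤ A) → ∀ i, u i ≤ c + A / 2) (i : ι) : u i ≤ 2 * c := by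
  have : Nonempty ι := ⟨i⟩
  have h1 : ∀ i, u i ≤ max (⨆ j, u j) 0 := fun i => (le_ciSup hb i).trans (le_max_left _ _)
  have h2 := ciSup_le (step _ (le_max_right _ _) h1)
  have h3 := le_ciSup hb i
  rcases max_cases (⨆ j, u j) 0 with ⟨h, _⟩ | ⟨h, _⟩ <;> rw [h] at h2 <;> linarith

/-- At a maximum over `[0,T]` attained after the initial time, the one-sided time derivative is
nonnegative. -/
theorem deriv_nonneg_of_isMaxOn_Icc {T t d : ℝ} {g : ℝ → ℝ} (ht : t ∈ Ioc 0 T)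
    (hg : HasDerivWithinAt g d (Icc 0 T) t) (hm : ∀ s ∈ Icc 0 T, g s ≤ g t) : 0 ≤ d := by
  have h1 : HasDerivWithinAt g d (Ico 0 t) t :=
    hg.mono fun s hs => ⟨hs.1, hs.2.le.trans ht.2⟩
  rw [hasDerivWithinAt_iff_tendsto_slope' (by simp)] at h1
  have : (𝓝[Ico 0 t] t).NeBot := by
    rw [← mem_closure_iff_nhdsWithin_neBot, closure_Ico ht.1.ne]
    exact right_mem_Icc.2 ht.1.le
  refine ge_of_tendsto h1 ?_
  filter_upwards [self_mem_nhdsWithin] with s hs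
  rw [slope_def_field]
  refine div_nonneg_of_nonpos ?_ ?_
  · linarith [hm s ⟨hs.1, hs.2.le.trans ht.2⟩]
  · linarith [hs.2]

/-- If w were positive somewhere, w - εt would attain a maximum over the compact set at a point
where w is positive and maximal in space. There the time derivative of w is at most 0 by hypothesis
and at least ε by maximality. -/
theorem nonpos_of_max_principle {T : ℝ} {w : ℝ → ℝ → ℝ → ℝ} {K : Set (ℝ × ℝ)} (hK : IsCompact K)
    (hw : ContinuousOn (fun p : ℝ × ℝ × ℝ => w p.1 p.2.1 p.2.2) (Icc 0 T ×ˢ univ))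
    (hwK : ∀ t ∈ Icc 0 T, ∀ x v, (x, v) ∉ K → w t x v ≤ 0)
    (h0 : ∀ x v, w 0 x v ≤ 0)
    (hd : ∀ t ∈ Ioc 0 T, ∀ x v, 0 < w t x v → (∀ y u, w t y u ≤ w t x v) →
      ∃ d ≤ 0, HasDerivWithinAt (fun s => w s x v) d (Icc 0 T) t) :
    ∀ t ∈ Icc 0 T, ∀ x v, w t x v ≤ 0 := by
  intro t₀ ht₀ x₀ v₀
  by_contra! hpos
  -- With this ε the correction εT is less than half of the positive value, so w is still positive
  -- at the maximum of w - εt.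
  set ε := w t₀ x₀ v₀ / (2 * (T + 1)) with hε
  have hT0 : 0 ≤ T := ht₀.1.trans ht₀.2
  have hε0 : 0 < ε := by positivity
  have hεT : ε * (T + 1) = w t₀ x₀ v₀ / 2 := by rw [hε]; field_simp
  have hmem : (x₀, v₀) ∈ K := by
    by_contra h
    exact absurd (hwK t₀ ht₀ x₀ v₀ h) (not_le.2 hpos)
  have hcont : ContinuousOn (fun p : ℝ × ℝ × ℝ => w p.1 p.2.1 p.2.2 - ε * p.1) (Icc 0 T ×ˢ K) :=
    (hw.mono (prod_mono_right (subset_univ _))).sub (by fun_prop)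
  obtain ⟨⟨t, x, v⟩, ⟨ht, hxv⟩, hmax⟩ := (isCompact_Icc.prod hK).exists_isMaxOn
    ⟨(t₀, x₀, v₀), ⟨ht₀, hmem⟩⟩ hcont
  have hmax' : ∀ s ∈ Icc 0 T, ∀ y u, (y, u) ∈ K → w s y u - ε * s ≤ w t x v - ε * t :=
    fun s hs y u hyu => hmax (show (s, y, u) ∈ Icc 0 T ×ˢ K from ⟨hs, hyu⟩)
  simp only at ht hxv
  have h1 := hmax' t₀ ht₀ x₀ v₀ hmem
  have h2 : ε * t₀ ≤ ε * T := by gcongr; exact ht₀.2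
  have hwpos : 0 < w t x v := by
    have : 0 ≤ ε * t := mul_nonneg hε0.le ht.1
    nlinarith
  have ht0 : 0 < t := by
    refine lt_of_le_of_ne ht.1 fun h => ?_
    rw [← h] at hwpos
    exact absurd (h0 x v) (not_le.2 hwpos)
  obtain ⟨d, hd0, hdd⟩ := hd t ⟨ht0, ht.2⟩ x v hwpos fun y u => by
    by_cases hyu : (y, u) ∈ K
    · linarith [hmax' t ht y u hyu]
    · exact (hwK t ht y u hyu).trans hwpos.le
  have h3 : HasDerivWithinAt (fun s => w s x v - ε * s) (d - ε * 1) (Icc 0 T) t :=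
    hdd.sub ((hasDerivWithinAt_id t _).const_mul ε)
  have := deriv_nonneg_of_isMaxOn_Icc ⟨ht0, ht.2⟩ h3 fun s hs => hmax' s hs x v hxv
  linarith

theorem abs_sub_le_of_abs_deriv_le {T : ℝ} {u u' β β' : ℝ → ℝ}
    (hu : ∀ s ∈ Icc 0 T, HasDerivWithinAt u (u' s) (Icc 0 T) s)
    (hβ : ∀ s, HasDerivAt β (β' s) s) (hb : ∀ s ∈ Icc 0 T, |u' s| ≤ β' s) {t : ℝ}
    (ht : t ∈ Icc 0 T) : |u t - u 0| ≤ β t - β 0 := by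
  have hc : ContinuousOn (fun s => u s - u 0) (Icc 0 T) :=
    fun s hs => ((hu s hs).continuousWithinAt).sub continuousWithinAt_const
  refine image_norm_le_of_norm_deriv_right_le_deriv_boundary' (f := fun s => u s - u 0)
    (f' := u') (B := fun s => β s - β 0) (B' := β') hc ?_ (by simp) ?_ ?_ ?_ ht
  · intro x hx
    exact ((hu x ⟨hx.1, hx.2.le⟩).mono_of_mem_nhdsWithin (Icc_mem_nhdsGE_of_mem hx)).sub_const _
  · exact fun x _ => ((hβ x).sub_const _).continuousAt.continuousWithinAt
  · exact fun x _ => ((hβ x).sub_const _).hasDerivWithinAt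
  · exact fun x hx => hb x ⟨hx.1, hx.2.le⟩

theorem hasDerivAt_div_mul_exp {l : ℝ} (hl : l ≠ 0) (c s : ℝ) :
    HasDerivAt (fun s => c / l * Real.exp (l * s)) (c * Real.exp (l * s)) s := by
  have := (((hasDerivAt_id s).const_mul l).exp).const_mul (c / l)
  refine this.congr_deriv ?_
  simp only [id]
  field_simp

theorem abs_integral_le_of_support {g : ℝ → ℝ} {r M : ℝ} (hr : 0 ≤ r)
    (hg : ∀ v, g v ≠ 0 → |v| ≤ r) (hM : ∀ v, |g v| ≤ M) : |∫ v, g v| ≤ 2 * r * M := by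
  rw [← MeasureTheory.setIntegral_eq_integral_of_forall_compl_eq_zero (s := Icc (-r) r)]
  · have := MeasureTheory.norm_setIntegral_le_of_norm_le_const (f := g) (s := Icc (-r) r)
      (μ := MeasureTheory.volume) (C := M) (by rw [Real.volume_Icc]; exact ENNReal.ofReal_lt_top)
      fun v _ => hM v
    rw [MeasureTheory.measureReal_def, Real.volume_Icc, ENNReal.toReal_ofReal (by linarith)] at this
    exact this.trans (le_of_eq (by ring))
  · intro v hv
    by_contra h
    exact hv (abs_le.1 (hg v h))

theorem integrable_of_support {g : ℝ → ℝ} {r : ℝ} (hc : Continuous g)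
    (hg : ∀ v, g v ≠ 0 → |v| ≤ r) : MeasureTheory.Integrable g := by
  refine hc.integrable_of_hasCompactSupport (HasCompactSupport.intro (K := Icc (-r) r)
    isCompact_Icc fun v hv => ?_)
  by_contra h
  exact hv (abs_le.1 (hg v h))

/-! ### Partial derivatives and bounds for the regularity classes -/

section Class

variable {T : ℝ}

theorem IsDensityClass.continuousOn {f : ℝ → ℝ → ℝ → ℝ} (hf : IsDensityClass T f) :
    ContinuousOn (fun p : ℝ × ℝ × ℝ => f p.1 p.2.1 p.2.2) (Icc 0 T ×ˢ univ) :=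
  hf.1.continuousOn

theorem IsDensityClass.hasFDerivWithinAt {f : ℝ → ℝ → ℝ → ℝ} (hf : IsDensityClass T f) {t : ℝ}
    (ht : t ∈ Icc 0 T) (x v : ℝ) :
    HasFDerivWithinAt (fun p : ℝ × ℝ × ℝ => f p.1 p.2.1 p.2.2)
      (fderivWithin ℝ (fun p : ℝ × ℝ × ℝ => f p.1 p.2.1 p.2.2) (Icc 0 T ×ˢ univ) (t, x, v))
      (Icc 0 T ×ˢ univ) (t, x, v) :=
  (hf.1.differentiableOn one_ne_zero (t, x, v) ⟨ht, mem_univ _⟩).hasFDerivWithinAt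

theorem IsDensityClass.hasDerivWithinAt_time {f : ℝ → ℝ → ℝ → ℝ} (hf : IsDensityClass T f)
    {t : ℝ} (ht : t ∈ Icc 0 T) (x v : ℝ) :
    HasDerivWithinAt (fun s => f s x v) (derivWithin (fun s => f s x v) (Icc 0 T) t)
      (Icc 0 T) t := by
  have := (hf.hasFDerivWithinAt ht x v).comp_hasDerivWithinAt (s := Icc 0 T) (f := fun s => (s, x, v)) t
    ((hasDerivWithinAt_id t _).prodMk (hasDerivWithinAt_const t _ (x, v)))
    fun s hs => ⟨hs, mem_univ _⟩
  exact this.differentiableWithinAt.hasDerivWithinAt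

theorem IsDensityClass.hasDerivAt_position_fderivWithin {f : ℝ → ℝ → ℝ → ℝ}
    (hf : IsDensityClass T f) {t : ℝ} (ht : t ∈ Icc 0 T) (x v : ℝ) :
    HasDerivAt (fun y => f t y v) (fderivWithin ℝ (fun p : ℝ × ℝ × ℝ => f p.1 p.2.1 p.2.2)
      (Icc 0 T ×ˢ univ) (t, x, v) (0, 1, 0)) x := by
  rw [← hasDerivWithinAt_univ]
  exact (hf.hasFDerivWithinAt ht x v).comp_hasDerivWithinAt (s := univ) (f := fun y => (t, y, v)) x
    ((hasDerivWithinAt_const x _ t).prodMk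
      ((hasDerivWithinAt_id x _).prodMk (hasDerivWithinAt_const x _ v)))
    fun s _ => ⟨ht, mem_univ _⟩

theorem IsDensityClass.hasDerivAt_velocity_fderivWithin {f : ℝ → ℝ → ℝ → ℝ}
    (hf : IsDensityClass T f) {t : ℝ} (ht : t ∈ Icc 0 T) (x v : ℝ) :
    HasDerivAt (fun w => f t x w) (fderivWithin ℝ (fun p : ℝ × ℝ × ℝ => f p.1 p.2.1 p.2.2)
      (Icc 0 T ×ˢ univ) (t, x, v) (0, 0, 1)) v := by
  rw [← hasDerivWithinAt_univ]
  exact (hf.hasFDerivWithinAt ht x v).comp_hasDerivWithinAt (s := univ) (f := fun w => (t, x, w)) v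
    ((hasDerivWithinAt_const v _ t).prodMk
      ((hasDerivWithinAt_const v _ x).prodMk (hasDerivWithinAt_id v _)))
    fun s _ => ⟨ht, mem_univ _⟩

theorem IsDensityClass.hasDerivAt_position {f : ℝ → ℝ → ℝ → ℝ} (hf : IsDensityClass T f) {t : ℝ}
    (ht : t ∈ Icc 0 T) (x v : ℝ) :
    HasDerivAt (fun y => f t y v) (deriv (fun y => f t y v) x) x :=
  (hf.hasDerivAt_position_fderivWithin ht x v).differentiableAt.hasDerivAt

theorem IsDensityClass.hasDerivAt_velocity {f : ℝ → ℝ → ℝ → ℝ} (hf : IsDensityClass T f) {t : ℝ}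
    (ht : t ∈ Icc 0 T) (x v : ℝ) :
    HasDerivAt (fun w => f t x w) (deriv (fun w => f t x w) v) v :=
  (hf.hasDerivAt_velocity_fderivWithin ht x v).differentiableAt.hasDerivAt

theorem IsDensityClass.exists_support {f : ℝ → ℝ → ℝ → ℝ} (hf : IsDensityClass T f) :
    ∃ r > 0, ∀ t ∈ Icc 0 T, ∀ x v, f t x v ≠ 0 → |x| ≤ r ∧ |v| ≤ r := by
  obtain ⟨K, hK, H⟩ := hf.2
  obtain ⟨r, hr⟩ := hK.isBounded.exists_norm_le
  refine ⟨max r 1, lt_max_of_lt_right one_pos, fun t ht x v h => ?_⟩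
  have hm : (x, v) ∈ K := by
    by_contra hn
    exact h (H t ht x v hn)
  have := hr _ hm
  rw [Prod.norm_def] at this
  exact ⟨((le_max_left _ _).trans this).trans (le_max_left _ _),
    ((le_max_right _ _).trans this).trans (le_max_left _ _)⟩

theorem IsDensityClass.continuous_velocity {f : ℝ → ℝ → ℝ → ℝ} (hf : IsDensityClass T f) {t : ℝ}
    (ht : t ∈ Icc 0 T) (x : ℝ) : Continuous fun v => f t x v :=
  continuous_iff_continuousAt.2 fun v => (hf.hasDerivAt_velocity ht x v).continuousAt

theorem IsDensityClass.exists_bound (hT : 0 < T) {f : ℝ → ℝ → ℝ → ℝ} (hf : IsDensityClass T f) :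
    ∃ C ≥ 0, ∀ t ∈ Icc 0 T, ∀ x v, |f t x v| ≤ C ∧ |deriv (fun y => f t y v) x| ≤ C ∧
      |deriv (fun w => f t x w) v| ≤ C := by
  obtain ⟨r, hr, hsupp⟩ := hf.exists_support
  have hU : UniqueDiffOn ℝ (Icc 0 T ×ˢ (univ : Set (ℝ × ℝ))) :=
    (uniqueDiffOn_Icc hT).prod uniqueDiffOn_univ
  have hcd := hf.1.continuousOn_fderivWithin hU le_rfl
  set K : Set (ℝ × ℝ) := Icc (-r) r ×ˢ Icc (-r) r with hKdef
  have hK : IsCompact (Icc 0 T ×ˢ K) := isCompact_Icc.prod (isCompact_Icc.prod isCompact_Icc)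
  have hsub : Icc 0 T ×ˢ K ⊆ Icc 0 T ×ˢ univ := prod_mono_right (subset_univ _)
  obtain ⟨C₁, h₁⟩ := hK.exists_bound_of_continuousOn (hf.continuousOn.mono hsub)
  obtain ⟨C₂, h₂⟩ := hK.exists_bound_of_continuousOn
    ((hcd.clm_apply (continuousOn_const (c := ((0, 1, 0) : ℝ × ℝ × ℝ)))).mono hsub)
  obtain ⟨C₃, h₃⟩ := hK.exists_bound_of_continuousOn
    ((hcd.clm_apply (continuousOn_const (c := ((0, 0, 1) : ℝ × ℝ × ℝ)))).mono hsub)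
  refine ⟨max (max C₁ C₂) (max C₃ 0), (le_max_right _ _).trans (le_max_right _ _), fun t ht x v => ?_⟩
  by_cases hxv : (x, v) ∈ K
  · have hm : (t, x, v) ∈ Icc 0 T ×ˢ K := ⟨ht, hxv⟩
    rw [(hf.hasDerivAt_position_fderivWithin ht x v).deriv,
      (hf.hasDerivAt_velocity_fderivWithin ht x v).deriv]
    exact ⟨(h₁ _ hm).trans (by simp), (h₂ _ hm).trans (by simp), (h₃ _ hm).trans (by simp)⟩
  · have hz : ∀ y w, (y, w) ∉ K → f t y w = 0 := by
      intro y w hyw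
      by_contra h
      have := hsupp t ht y w h
      exact hyw ⟨abs_le.1 this.1, abs_le.1 this.2⟩
    have hopen : Kᶜ ∈ 𝓝 (x, v) :=
      (isClosed_Icc.prod isClosed_Icc).isOpen_compl.mem_nhds hxv
    have e1 : (fun y => f t y v) =ᶠ[𝓝 x] fun _ => 0 := by
      have : Tendsto (fun y => (y, v)) (𝓝 x) (𝓝 (x, v)) :=
        (continuous_id.prodMk continuous_const).tendsto x
      filter_upwards [this hopen] with y hy using hz y v hy
    have e2 : (fun w => f t x w) =ᶠ[𝓝 v] fun _ => 0 := by
      have : Tendsto (fun w => (x, w)) (𝓝 v) (𝓝 (x, v)) :=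
        (continuous_const.prodMk continuous_id).tendsto v
      filter_upwards [this hopen] with y hy using hz x y hy
    rw [e1.deriv_eq, e2.deriv_eq, hz x v hxv]
    simp

theorem IsFieldClass.hasFDerivWithinAt {B : ℝ → ℝ → ℝ} (hB : IsFieldClass T B) {t : ℝ}
    (ht : t ∈ Icc 0 T) (x : ℝ) :
    HasFDerivWithinAt (fun p : ℝ × ℝ => B p.1 p.2)
      (fderivWithin ℝ (fun p : ℝ × ℝ => B p.1 p.2) (Icc 0 T ×ˢ univ) (t, x))
      (Icc 0 T ×ˢ univ) (t, x) :=
  (ContDiffOn.differentiableOn hB one_ne_zero (t, x) ⟨ht, mem_univ _⟩).hasFDerivWithinAt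

theorem IsFieldClass.hasDerivWithinAt_time {B : ℝ → ℝ → ℝ} (hB : IsFieldClass T B) {t : ℝ}
    (ht : t ∈ Icc 0 T) (x : ℝ) :
    HasDerivWithinAt (fun s => B s x) (fderivWithin ℝ (fun p : ℝ × ℝ => B p.1 p.2)
      (Icc 0 T ×ˢ univ) (t, x) (1, 0)) (Icc 0 T) t :=
  (hB.hasFDerivWithinAt ht x).comp_hasDerivWithinAt (s := Icc 0 T) (f := fun s => (s, x)) t
    ((hasDerivWithinAt_id t _).prodMk (hasDerivWithinAt_const t _ x))
    fun _ hs => ⟨hs, mem_univ _⟩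

theorem IsFieldClass.hasDerivAt_position {B : ℝ → ℝ → ℝ} (hB : IsFieldClass T B) {t : ℝ}
    (ht : t ∈ Icc 0 T) (x : ℝ) :
    HasDerivAt (fun y => B t y) (fderivWithin ℝ (fun p : ℝ × ℝ => B p.1 p.2)
      (Icc 0 T ×ˢ univ) (t, x) (0, 1)) x := by
  rw [← hasDerivWithinAt_univ]
  exact (hB.hasFDerivWithinAt ht x).comp_hasDerivWithinAt (s := univ) (f := fun y => (t, y)) x
    ((hasDerivWithinAt_const x _ t).prodMk (hasDerivWithinAt_id x _))
    fun s _ => ⟨ht, mem_univ _⟩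

end Class

/-! ### Uniqueness -/

section Solution

variable {T : ℝ} {f₀ : ℝ × ℝ → ℝ} {B₀ : ℝ → ℝ} {f : ℝ → ℝ → ℝ → ℝ} {B : ℝ → ℝ → ℝ}

/-- Along a line of speed one, the field changes at the rate `∫ f dv`. -/
theorem IsClassicalSolution.hasDerivWithinAt_field (h : IsClassicalSolution f₀ B₀ T f B) {t : ℝ}
    (ht : t ∈ Icc 0 T) (y : ℝ) :
    HasDerivWithinAt (fun s => B s (y + s)) (∫ v, f t (y + t) v) (Icc 0 T) t := by
  have key := (h.field.hasFDerivWithinAt ht (y + t)).comp_hasDerivWithinAt (s := Icc 0 T)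
    (f := fun s => (s, y + s)) t
    ((hasDerivWithinAt_id t _).prodMk ((hasDerivWithinAt_id t _).const_add y))
    fun s hs => ⟨hs, mem_univ _⟩
  have e : ((1 : ℝ), (1 : ℝ)) = (1, 0) + (0, 1) := by simp
  rw [e, map_add, ← (h.field.hasDerivAt_position ht (y + t)).deriv,
    ← (h.field.hasDerivWithinAt_time ht (y + t)).derivWithin (uniqueDiffOn_Icc h.pos t ht),
    h.transport t ht] at key
  exact key

theorem IsClassicalSolution.hasDerivWithinAt_density (h : IsClassicalSolution f₀ B₀ T f B) {t : ℝ}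
    (ht : t ∈ Icc 0 T) (x v : ℝ) :
    HasDerivWithinAt (fun s => f s x v)
      (-(v * deriv (fun y => f t y v) x) - B t x * deriv (fun w => f t x w) v) (Icc 0 T) t := by
  convert h.density.hasDerivWithinAt_time ht x v using 1
  linarith [h.vlasov t ht x v]

/-- At a spatial maximum of ±(f - g) both solutions have the same spatial gradient, so the
difference of the two Vlasov equations reduces to -(B - D) ∂ᵥg. A bound A e^{lt} for f - g bounds B
- D by (2rA/l) e^{lt}, and the maximum principle then improves the first bound to (A/2) e^{lt}. -/
theorem IsClassicalSolution.eq_of_eq_data {g : ℝ → ℝ → ℝ → ℝ} {D : ℝ → ℝ → ℝ}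
    (h : IsClassicalSolution f₀ B₀ T f B) (h' : IsClassicalSolution f₀ B₀ T g D) :
    ∀ t ∈ Icc 0 T, ∀ x : ℝ, (∀ v : ℝ, f t x v = g t x v) ∧ B t x = D t x := by
  have hT := h.pos
  obtain ⟨r₁, hr₁, hs₁⟩ := h.density.exists_support
  obtain ⟨r₂, hr₂, hs₂⟩ := h'.density.exists_support
  obtain ⟨C₁, hC₁, hb₁⟩ := h.density.exists_bound hT
  obtain ⟨C, hC, hb₂⟩ := h'.density.exists_bound hT
  set r := max r₁ r₂ with hr
  have hr0 : 0 < r := lt_max_of_lt_left hr₁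
  have hsupp : ∀ t ∈ Icc 0 T, ∀ x v, f t x v - g t x v ≠ 0 → |x| ≤ r ∧ |v| ≤ r := by
    intro t ht x v hne
    by_cases hf : f t x v = 0
    · have := hs₂ t ht x v (by rintro hg; simp [hf, hg] at hne)
      exact ⟨this.1.trans (le_max_right _ _), this.2.trans (le_max_right _ _)⟩
    · have := hs₁ t ht x v hf
      exact ⟨this.1.trans (le_max_left _ _), this.2.trans (le_max_left _ _)⟩
  -- Here r bounds the velocities in both supports and C bounds ∂ᵥg. The halving step needs (2rA/l)
  -- C ≤ (A/2) l, that is 4rC ≤ l².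
  set l := 4 * r * C + 1 with hl
  have hl1 : 1 ≤ l := by rw [hl]; have : 0 ≤ 4 * r * C := by positivity
                         linarith
  have hl0 : 0 < l := by linarith
  have hexp : ∀ c s : ℝ, HasDerivAt (fun s => c / l * Real.exp (l * s)) (c * Real.exp (l * s)) s :=
    fun c s => hasDerivAt_div_mul_exp hl0.ne' c s
  -- the fields are controlled by the densities
  have hfield : ∀ A, 0 ≤ A → (∀ t ∈ Icc 0 T, ∀ x v, |f t x v - g t x v| ≤ A * Real.exp (l * t)) →
      ∀ t ∈ Icc 0 T, ∀ x, |B t x - D t x| ≤ 2 * r * A / l * Real.exp (l * t) := by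
    intro A hA hAb t ht x
    have hu : ∀ s ∈ Icc 0 T, HasDerivWithinAt (fun s => B s (x - t + s) - D s (x - t + s))
        ((∫ v, f s (x - t + s) v) - ∫ v, g s (x - t + s) v) (Icc 0 T) s :=
      fun s hs => (h.hasDerivWithinAt_field hs _).sub (h'.hasDerivWithinAt_field hs _)
    have := abs_sub_le_of_abs_deriv_le hu (hexp (2 * r * A)) (fun s hs => ?_) ht
    · have e : x - t + t = x := by ring
      simp only [e, h.init_field, h'.init_field, sub_self, sub_zero, mul_zero, Real.exp_zero,
        mul_one] at this
      have : 0 ≤ 2 * r * A / l := by positivity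
      linarith
    · rw [← MeasureTheory.integral_sub
        (integrable_of_support (h.density.continuous_velocity hs _) fun v hv => (hs₁ s hs _ v hv).2)
        (integrable_of_support (h'.density.continuous_velocity hs _) fun v hv => (hs₂ s hs _ v hv).2)]
      refine (abs_integral_le_of_support hr0.le (fun v hv => (hsupp s hs _ v hv).2)
        (fun v => hAb s hs _ v)).trans (le_of_eq (by ring))
  have hstep : ∀ A, 0 ≤ A → (∀ t ∈ Icc 0 T, ∀ x v, |f t x v - g t x v| ≤ A * Real.exp (l * t)) →
      ∀ σ : ℝ, |σ| = 1 →
      ∀ t ∈ Icc 0 T, ∀ x v, σ * (f t x v - g t x v) - A / 2 * Real.exp (l * t) ≤ 0 := by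
    intro A hA hAb σ hσ
    refine nonpos_of_max_principle (K := Icc (-r) r ×ˢ Icc (-r) r)
      (w := fun t x v => σ * (f t x v - g t x v) - A / 2 * Real.exp (l * t))
      (isCompact_Icc.prod isCompact_Icc) ?_ ?_ ?_ ?_
    · exact (continuousOn_const.mul (h.density.continuousOn.sub h'.density.continuousOn)).sub
        (by fun_prop)
    · intro t ht x v hxv
      have : f t x v - g t x v = 0 := by
        by_contra hne
        have := hsupp t ht x v hne
        exact hxv ⟨abs_le.1 this.1, abs_le.1 this.2⟩
      rw [this]
      have : 0 ≤ A / 2 * Real.exp (l * t) := by positivity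
      linarith
    · intro x v
      rw [h.init_density, h'.init_density]
      simp only [sub_self, mul_zero, Real.exp_zero]
      linarith
    · intro t ht x v hpos hmax
      have ht' : t ∈ Icc 0 T := ⟨ht.1.le, ht.2⟩
      have hx : deriv (fun y => f t y v) x - deriv (fun y => g t y v) x = 0 := by
        have hd := (h.density.hasDerivAt_position ht' x v).sub (h'.density.hasDerivAt_position ht' x v)
        have hm : IsLocalMax (fun y => σ * (f t y v - g t y v) - A / 2 * Real.exp (l * t)) x :=
          Eventually.of_forall fun y => hmax y v
        have h0 := hm.hasDerivAt_eq_zero ((hd.const_mul σ).sub_const _)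
        rcases mul_eq_zero.1 h0 with h0 | h0
        · simp [h0] at hσ
        · exact h0
      have hv : deriv (fun w => f t x w) v - deriv (fun w => g t x w) v = 0 := by
        have hd := (h.density.hasDerivAt_velocity ht' x v).sub (h'.density.hasDerivAt_velocity ht' x v)
        have hm : IsLocalMax (fun w => σ * (f t x w - g t x w) - A / 2 * Real.exp (l * t)) v :=
          Eventually.of_forall fun w => hmax x w
        have h0 := hm.hasDerivAt_eq_zero ((hd.const_mul σ).sub_const _)
        rcases mul_eq_zero.1 h0 with h0 | h0
        · simp [h0] at hσ
        · exact h0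
      have hft := h.hasDerivWithinAt_density ht' x v
      have hgt := h'.hasDerivWithinAt_density ht' x v
      have he := (((hasDerivAt_id t).const_mul l).exp.const_mul (A / 2)).hasDerivWithinAt (s := Icc 0 T)
      refine ⟨_, ?_, ((hft.sub hgt).const_mul σ).sub he⟩
      simp only [id, mul_one]
      have e1 : σ * (-(v * deriv (fun y => f t y v) x) - B t x * deriv (fun w => f t x w) v -
          (-(v * deriv (fun y => g t y v) x) - D t x * deriv (fun w => g t x w) v))
          = σ * (-(B t x - D t x) * deriv (fun w => g t x w) v) := by
        have a1 : deriv (fun y => f t y v) x = deriv (fun y => g t y v) x := by linarith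
        have a2 : deriv (fun w => f t x w) v = deriv (fun w => g t x w) v := by linarith
        rw [a1, a2]; ring
      have e2 : |σ * (-(B t x - D t x) * deriv (fun w => g t x w) v)|
          ≤ 2 * r * A / l * Real.exp (l * t) * C := by
        rw [abs_mul, hσ, one_mul, abs_mul, abs_neg]
        have := hfield A hA hAb t ht' x
        have := (hb₂ t ht' x v).2.2
        gcongr
      have e3 : 2 * r * A / l * Real.exp (l * t) * C ≤ A / 2 * (Real.exp (l * t) * l) := by
        have hle : 4 * r * C ≤ l * l := by nlinarith
        have : 2 * r * A / l * Real.exp (l * t) * C = (4 * r * C / l) * (A / 2 * Real.exp (l * t)) := by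
          ring
        rw [this]
        have : 4 * r * C / l ≤ l := by rw [div_le_iff₀ hl0]; exact hle
        calc _ ≤ l * (A / 2 * Real.exp (l * t)) := by gcongr
          _ = _ := by ring
      rw [e1]
      linarith [le_abs_self (σ * (-(B t x - D t x) * deriv (fun w => g t x w) v))]
  have hfg : ∀ t ∈ Icc 0 T, ∀ x v, f t x v = g t x v := by
    have hhalf := le_of_halving (ι := Icc 0 T × ℝ × ℝ)
      (u := fun i => |f i.1 i.2.1 i.2.2 - g i.1 i.2.1 i.2.2| * Real.exp (-(l * i.1))) le_rfl
      ⟨C₁ + C, by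
        rintro _ ⟨⟨⟨t, ht⟩, x, v⟩, rfl⟩
        have h1 := (hb₁ t ht x v).1
        have h2 := (hb₂ t ht x v).1
        have h3 : Real.exp (-(l * t)) ≤ 1 := by
          rw [Real.exp_le_one_iff]
          have := mul_nonneg hl0.le ht.1
          linarith
        calc |f t x v - g t x v| * Real.exp (-(l * t)) ≤ (C₁ + C) * 1 := by
              gcongr
              exact (abs_sub _ _).trans (by linarith)
          _ = _ := mul_one _⟩
      (by
        rintro A hA hAi ⟨⟨t, ht⟩, x, v⟩
        have hAb : ∀ t ∈ Icc 0 T, ∀ x v, |f t x v - g t x v| ≤ A * Real.exp (l * t) := by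
          intro t ht x v
          have := hAi ⟨⟨t, ht⟩, x, v⟩
          simp only [Real.exp_neg] at this
          rwa [← div_eq_mul_inv, div_le_iff₀ (Real.exp_pos _)] at this
        have a1 := hstep A hA hAb 1 (by simp) t ht x v
        have a2 := hstep A hA hAb (-1) (by simp) t ht x v
        simp only [Real.exp_neg]
        rw [← div_eq_mul_inv, div_le_iff₀ (Real.exp_pos _), zero_add, abs_le]
        constructor <;> linarith)
    intro t ht x v
    have := hhalf ⟨⟨t, ht⟩, x, v⟩
    simp only [mul_zero] at this
    have h0 : |f t x v - g t x v| ≤ 0 := by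
      by_contra! hc
      exact absurd this (not_le.2 (mul_pos hc (Real.exp_pos _)))
    linarith [abs_nonpos_iff.1 h0]
  intro t ht x
  refine ⟨hfg t ht x, ?_⟩
  have := hfield 0 le_rfl (fun t ht x v => by simp [hfg t ht x v]) t ht x
  simp only [mul_zero, zero_div, zero_mul] at this
  linarith [abs_nonpos_iff.1 this]

end Solution

/-! ### A priori bounds: size of the density, support and field -/

section APriori

variable {T : ℝ} {f₀ : ℝ × ℝ → ℝ} {B₀ : ℝ → ℝ} {f : ℝ → ℝ → ℝ → ℝ} {B : ℝ → ℝ → ℝ}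

theorem IsClassicalSolution.abs_density_le (h : IsClassicalSolution f₀ B₀ T f B) {M : ℝ}
    (hM : ∀ z, |f₀ z| ≤ M) : ∀ t ∈ Icc 0 T, ∀ x v, |f t x v| ≤ M := by
  obtain ⟨r, hr, hs⟩ := h.density.exists_support
  have hM0 : 0 ≤ M := (abs_nonneg _).trans (hM 0)
  have key : ∀ σ : ℝ, |σ| = 1 → ∀ t ∈ Icc 0 T, ∀ x v, σ * f t x v - M ≤ 0 := by
    intro σ hσ
    have hσ0 : σ ≠ 0 := by rintro rfl; simp at hσ
    refine nonpos_of_max_principle (K := Icc (-r) r ×ˢ Icc (-r) r)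
      (w := fun t x v => σ * f t x v - M) (isCompact_Icc.prod isCompact_Icc) ?_ ?_ ?_ ?_
    · exact (continuousOn_const.mul h.density.continuousOn).sub continuousOn_const
    · intro t ht x v hxv
      have : f t x v = 0 := by
        by_contra hne
        have := hs t ht x v hne
        exact hxv ⟨abs_le.1 this.1, abs_le.1 this.2⟩
      rw [this]; linarith
    · intro x v
      rw [h.init_density]
      have := le_abs_self (σ * f₀ (x, v))
      rw [abs_mul, hσ, one_mul] at this
      linarith [hM (x, v)]
    · intro t ht x v hpos hmax
      have ht' : t ∈ Icc 0 T := ⟨ht.1.le, ht.2⟩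
      have hx : deriv (fun y => f t y v) x = 0 := by
        have hm : IsLocalMax (fun y => σ * f t y v - M) x := Eventually.of_forall fun y => hmax y v
        exact (mul_eq_zero.1 (hm.hasDerivAt_eq_zero
          (((h.density.hasDerivAt_position ht' x v).const_mul σ).sub_const _))).resolve_left hσ0
      have hv : deriv (fun w => f t x w) v = 0 := by
        have hm : IsLocalMax (fun w => σ * f t x w - M) v := Eventually.of_forall fun w => hmax x w
        exact (mul_eq_zero.1 (hm.hasDerivAt_eq_zero
          (((h.density.hasDerivAt_velocity ht' x v).const_mul σ).sub_const _))).resolve_left hσ0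
      exact ⟨_, by simp [hx, hv], ((h.hasDerivWithinAt_density ht' x v).const_mul σ).sub_const M⟩
  intro t ht x v
  have a1 := key 1 (by simp) t ht x v
  have a2 := key (-1) (by simp) t ht x v
  rw [abs_le]
  constructor <;> linarith

/-- Finite speed of propagation: the support of the density stays in a moving half-plane that
recedes faster than the characteristics inside the support. -/
theorem IsClassicalSolution.support_subset_halfPlane (h : IsClassicalSolution f₀ B₀ T f B)
    (hf₀ : ∃ M, ∀ z, |f₀ z| ≤ M) {a b : ℝ} {p p' : ℝ → ℝ} (hp : ∀ s, HasDerivAt p (p' s) s)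
    (h0 : ∀ x v, f₀ (x, v) ≠ 0 → a * x + b * v ≤ p 0)
    (hspeed : ∀ t ∈ Icc 0 T, ∀ x v, f t x v ≠ 0 → a * v + b * B t x ≤ p' t) :
    ∀ t ∈ Icc 0 T, ∀ x v, f t x v ≠ 0 → a * x + b * v ≤ p t := by
  obtain ⟨M, hM⟩ := hf₀
  obtain ⟨r, hr, hs⟩ := h.density.exists_support
  -- The exponential weight with large k penalizes points outside the half-plane, while initially it
  -- is at most 1 on the support. The square makes the estimate independent of the sign of f.
  have key : ∀ k : ℝ, 0 ≤ k → ∀ t ∈ Icc 0 T, ∀ x v,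
      f t x v ^ 2 * Real.exp (k * (a * x + b * v - p t)) - M ^ 2 ≤ 0 := by
    intro k hk
    refine nonpos_of_max_principle (K := Icc (-r) r ×ˢ Icc (-r) r)
      (w := fun t x v => f t x v ^ 2 * Real.exp (k * (a * x + b * v - p t)) - M ^ 2)
      (isCompact_Icc.prod isCompact_Icc) ?_ ?_ ?_ ?_
    · have hpc : Continuous p := continuous_iff_continuousAt.2 fun s => (hp s).continuousAt
      exact ((h.density.continuousOn.pow 2).mul (by fun_prop)).sub continuousOn_const
    · intro t ht x v hxv
      have : f t x v = 0 := by
        by_contra hne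
        have := hs t ht x v hne
        exact hxv ⟨abs_le.1 this.1, abs_le.1 this.2⟩
      rw [this]
      nlinarith [sq_nonneg M]
    · intro x v
      rw [h.init_density]
      by_cases hne : f₀ (x, v) = 0
      · rw [hne]; nlinarith [sq_nonneg M]
      · have h1 : f₀ (x, v) ^ 2 ≤ M ^ 2 := sq_le_sq.2 ((hM _).trans (le_abs_self _))
        have h2 : Real.exp (k * (a * x + b * v - p 0)) ≤ 1 := by
          rw [Real.exp_le_one_iff]
          exact mul_nonpos_of_nonneg_of_nonpos hk (by linarith [h0 x v hne])
        have := mul_le_mul h1 h2 (Real.exp_pos _).le (sq_nonneg M)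
        linarith
    · intro t ht x v hpos hmax
      have ht' : t ∈ Icc 0 T := ⟨ht.1.le, ht.2⟩
      have hne : f t x v ≠ 0 := by
        intro h0
        rw [h0] at hpos
        nlinarith [sq_nonneg M]
      set E := Real.exp (k * (a * x + b * v - p t)) with hE
      have hE0 : 0 < E := Real.exp_pos _
      have hx : 2 * f t x v * deriv (fun y => f t y v) x * E
          + f t x v ^ 2 * (E * (k * a)) = 0 := by
        have hm : IsLocalMax
            (fun y => f t y v ^ 2 * Real.exp (k * (a * y + b * v - p t)) - M ^ 2) x :=
          Eventually.of_forall fun y => hmax y v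
        have hd := (((h.density.hasDerivAt_position ht' x v).pow 2).mul
          ((((((hasDerivAt_id x).const_mul a).add_const (b * v)).sub_const (p t)).const_mul k).exp)).sub_const
            (M ^ 2)
        have := hm.hasDerivAt_eq_zero hd
        simp only [id, Pi.pow_apply, ← hE] at this
        rw [← this]; push_cast; ring
      have hv : 2 * f t x v * deriv (fun w => f t x w) v * E
          + f t x v ^ 2 * (E * (k * b)) = 0 := by
        have hm : IsLocalMax
            (fun w => f t x w ^ 2 * Real.exp (k * (a * x + b * w - p t)) - M ^ 2) v :=
          Eventually.of_forall fun w => hmax x w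
        have hd := (((h.density.hasDerivAt_velocity ht' x v).pow 2).mul
          ((((((hasDerivAt_id v).const_mul b).const_add (a * x)).sub_const (p t)).const_mul k).exp)).sub_const
            (M ^ 2)
        have := hm.hasDerivAt_eq_zero hd
        simp only [id, Pi.pow_apply, ← hE] at this
        rw [← this]; push_cast; ring
      have hd := (((h.hasDerivWithinAt_density ht' x v).pow 2).mul
        ((((hp t).hasDerivWithinAt (s := Icc 0 T)).const_sub (a * x + b * v)).const_mul k).exp).sub_const
          (M ^ 2)
      refine ⟨_, ?_, hd⟩
      have hsp := hspeed t ht' x v hne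
      have e : f t x v ^ 2 * E * k * (a * v + b * B t x - p' t) ≤ 0 :=
        mul_nonpos_of_nonneg_of_nonpos (by positivity) (by linarith)
      refine le_trans (le_of_eq ?_) e
      simp only [← hE, Pi.pow_apply]
      push_cast
      -- The vanishing of both spatial derivatives eliminates ∂ₓf and ∂ᵥf from the time derivative.
      -- What remains is k times the speed relative to the half-plane, which is nonpositive on the
      -- support.
      linear_combination (-v) * hx - B t x * hv
  intro t ht x v hne
  by_contra! hlt
  set δ := a * x + b * v - p t with hδ
  have hδ0 : 0 < δ := by linarith
  have hf2 : 0 < f t x v ^ 2 := by positivity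
  -- This k makes kδ = M²/f², and e^{kδ} ≥ kδ + 1 then gives f² e^{kδ} ≥ M² + f² > M².
  have h1 := key (M ^ 2 / (f t x v ^ 2 * δ)) (by positivity) t ht x v
  have h2 := Real.add_one_le_exp (M ^ 2 / (f t x v ^ 2 * δ) * δ)
  have h3 : f t x v ^ 2 * (M ^ 2 / (f t x v ^ 2 * δ) * δ + 1) = M ^ 2 + f t x v ^ 2 := by
    field_simp
  have h4 := mul_le_mul_of_nonneg_left h2 hf2.le
  linarith

theorem IsClassicalSolution.abs_field_sub_le (h : IsClassicalSolution f₀ B₀ T f B)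
    {β β' : ℝ → ℝ} (hβ : ∀ s, HasDerivAt β (β' s) s)
    (hb : ∀ s ∈ Icc 0 T, ∀ x, |∫ v, f s x v| ≤ β' s) :
    ∀ t ∈ Icc 0 T, ∀ x, |B t x - B₀ (x - t)| ≤ β t - β 0 := by
  intro t ht x
  have := abs_sub_le_of_abs_deriv_le (u := fun s => B s (x - t + s))
    (fun s hs => h.hasDerivWithinAt_field hs (x - t)) hβ (fun s hs => hb s hs _) ht
  simpa [h.init_field] using this

/-- A bound for the velocities in the support that depends on the data and on `T` only. -/
theorem IsClassicalSolution.abs_velocity_le (h : IsClassicalSolution f₀ B₀ T f B) {M P₀ b : ℝ}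
    (hM : ∀ z, |f₀ z| ≤ M) (hP₀ : 0 ≤ P₀) (hf₀ : ∀ x v, f₀ (x, v) ≠ 0 → |v| ≤ P₀)
    (hb : ∀ x, |B₀ x| ≤ b) : ∀ t ∈ Icc 0 T, ∀ x v, f t x v ≠ 0 →
      |v| ≤ 2 * (P₀ + b * T) * Real.exp ((4 * M + 1) * T) := by
  classical
  have hM0 : 0 ≤ M := (abs_nonneg _).trans (hM 0)
  have hb0 : 0 ≤ b := (abs_nonneg _).trans (hb 0)
  have hT := h.pos
  obtain ⟨r, hr, hs⟩ := h.density.exists_support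
  -- A velocity bound A e^{lt} gives a field bound b + (2AM/l) e^{lt}. Integrating once more gives
  -- velocities up to P₀ + bt + (2AM/l²) e^{lt}, so halving requires 4M ≤ l².
  set l := 4 * M + 1 with hl
  have hl0 : 0 < l := by linarith
  have hfM := h.abs_density_le hM
  have hexp : ∀ c s : ℝ, HasDerivAt (fun s => c / l * Real.exp (l * s)) (c * Real.exp (l * s)) s :=
    fun c s => hasDerivAt_div_mul_exp hl0.ne' c s
  have hhalf := le_of_halving (ι := Icc 0 T × ℝ × ℝ) (c := P₀ + b * T)
    -- The value 0 off the support makes this a bounded function on all of phase space. The support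
    -- radius r of this particular solution is used only for finiteness and does not enter the final
    -- bound.
    (u := fun i => if f i.1 i.2.1 i.2.2 = 0 then 0 else |i.2.2| * Real.exp (-(l * i.1)))
    (by positivity)
    ⟨r, by
      rintro _ ⟨⟨⟨t, ht⟩, x, v⟩, rfl⟩
      simp only
      split_ifs with hf
      · exact hr.le
      · have h1 := (hs t ht x v hf).2
        have h3 : Real.exp (-(l * t)) ≤ 1 := by
          rw [Real.exp_le_one_iff]
          have := mul_nonneg hl0.le ht.1
          linarith
        calc |v| * Real.exp (-(l * t)) ≤ r * 1 := by gcongr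
          _ = _ := mul_one _⟩
    (by
      rintro A hA hAi ⟨⟨t, ht⟩, x, v⟩
      have hAb : ∀ t ∈ Icc 0 T, ∀ x v, f t x v ≠ 0 → |v| ≤ A * Real.exp (l * t) := by
        intro t ht x v hf
        have := hAi ⟨⟨t, ht⟩, x, v⟩
        simp only [hf, if_false, Real.exp_neg] at this
        rwa [← div_eq_mul_inv, div_le_iff₀ (Real.exp_pos _)] at this
      have hB : ∀ t ∈ Icc 0 T, ∀ x, |B t x| ≤ b + 2 * A * M / l * Real.exp (l * t) := by
        intro t ht x
        have h1 := h.abs_field_sub_le (hexp (2 * A * M)) (fun s hs x =>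
          (abs_integral_le_of_support (by positivity) (fun v hv => hAb s hs x v hv)
            (fun v => hfM s hs x v)).trans (le_of_eq (by ring))) t ht x
        have h2 : 0 ≤ 2 * A * M / l * Real.exp (l * 0) := by positivity
        have h3 := abs_sub_abs_le_abs_sub (B t x) (B₀ (x - t))
        linarith [hb (x - t)]
      have hstep : ∀ σ : ℝ, |σ| = 1 → ∀ t ∈ Icc 0 T, ∀ x v, f t x v ≠ 0 →
          0 * x + σ * v ≤ P₀ + b * t + 2 * A * M / l / l * Real.exp (l * t) := by
        intro σ hσ
        refine h.support_subset_halfPlane ⟨M, hM⟩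
          (p := fun t => P₀ + b * t + 2 * A * M / l / l * Real.exp (l * t))
          (p' := fun t => b + 2 * A * M / l * Real.exp (l * t)) ?_ ?_ ?_
        · intro s
          have := (((hasDerivAt_id s).const_mul b).const_add P₀).add (hexp (2 * A * M / l) s)
          exact this.congr_deriv (by simp)
        · intro x v hf
          have h1 := le_abs_self (σ * v)
          rw [abs_mul, hσ, one_mul] at h1
          have h2 : 0 ≤ 2 * A * M / l / l * Real.exp (l * 0) := by positivity
          have h3 := hf₀ x v hf
          simp only [mul_zero, add_zero, zero_mul, zero_add] at h2 ⊢
          linarith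
        · intro t ht x v _
          have h1 := le_abs_self (σ * B t x)
          rw [abs_mul, hσ, one_mul] at h1
          linarith [hB t ht x]
      simp only
      split_ifs with hf
      · positivity
      · have a1 := hstep 1 (by simp) t ht x v hf
        have a2 := hstep (-1) (by simp) t ht x v hf
        have a3 : |v| ≤ P₀ + b * t + 2 * A * M / l / l * Real.exp (l * t) := by
          rw [abs_le]; constructor <;> linarith
        have h3 : Real.exp (-(l * t)) ≤ 1 := by
          rw [Real.exp_le_one_iff]
          have := mul_nonneg hl0.le ht.1
          linarith
        have h4 : 2 * A * M / l / l ≤ A / 2 := by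
          rw [div_le_iff₀ hl0, div_le_iff₀ hl0]
          have : 4 * M ≤ l * l := by nlinarith
          nlinarith
        calc |v| * Real.exp (-(l * t))
            ≤ (P₀ + b * t + 2 * A * M / l / l * Real.exp (l * t)) * Real.exp (-(l * t)) := by gcongr
          _ = (P₀ + b * t) * Real.exp (-(l * t)) + 2 * A * M / l / l := by
              rw [add_mul, mul_assoc (2 * A * M / l / l), ← Real.exp_add]
              simp
          _ ≤ (P₀ + b * T) * 1 + A / 2 := by
              have := ht.2
              have : 0 ≤ P₀ + b * T := by positivity
              gcongr
          _ = _ := by ring)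
  intro t ht x v hf
  have := hhalf ⟨⟨t, ht⟩, x, v⟩
  simp only [hf, if_false, Real.exp_neg] at this
  rw [← div_eq_mul_inv, div_le_iff₀ (Real.exp_pos _)] at this
  refine this.trans ?_
  have := ht.2
  gcongr

theorem IsClassicalSolution.abs_position_le (h : IsClassicalSolution f₀ B₀ T f B) {X₀ P : ℝ}
    (hM : ∃ M, ∀ z, |f₀ z| ≤ M) (hf₀ : ∀ x v, f₀ (x, v) ≠ 0 → |x| ≤ X₀)
    (hP : ∀ t ∈ Icc 0 T, ∀ x v, f t x v ≠ 0 → |v| ≤ P) :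
    ∀ t ∈ Icc 0 T, ∀ x v, f t x v ≠ 0 → |x| ≤ X₀ + P * t := by
  have hstep : ∀ σ : ℝ, |σ| = 1 → ∀ t ∈ Icc 0 T, ∀ x v, f t x v ≠ 0 →
      σ * x + 0 * v ≤ X₀ + P * t := by
    intro σ hσ
    refine h.support_subset_halfPlane hM (p := fun t => X₀ + P * t) (p' := fun _ => P) ?_ ?_ ?_
    · intro s
      simpa using ((hasDerivAt_id s).const_mul P).const_add X₀
    · intro x v hf
      have h1 := le_abs_self (σ * x)
      rw [abs_mul, hσ, one_mul] at h1
      have := hf₀ x v hf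
      linarith
    · intro t ht x v hf
      have h1 := le_abs_self (σ * v)
      rw [abs_mul, hσ, one_mul] at h1
      have := hP t ht x v hf
      linarith
  intro t ht x v hf
  have a1 := hstep 1 (by simp) t ht x v hf
  have a2 := hstep (-1) (by simp) t ht x v hf
  rw [abs_le]
  constructor <;> linarith

end APriori

/-! ### The truncated problem: data and length of the time interval -/

/-- Projection of the real line onto `[-T, T]`. -/
def clamp (T t : ℝ) : ℝ := max (-T) (min T t)

@[fun_prop]
theorem continuous_clamp (T : ℝ) : Continuous (clamp T) := by
  unfold clamp; fun_prop

theorem abs_clamp_le {T : ℝ} (hT : 0 ≤ T) (t : ℝ) : |clamp T t| ≤ T :=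
  abs_le.2 ⟨le_max_left _ _, max_le (by linarith) (min_le_left _ _)⟩

theorem clamp_of_abs_le {T t : ℝ} (ht : |t| ≤ T) : clamp T t = t := by
  rw [abs_le] at ht
  rw [clamp, min_eq_right ht.2, max_eq_right ht.1]

theorem abs_clamp_sub_le {T : ℝ} (hT : 0 ≤ T) (s t : ℝ) : |clamp T s - clamp T t| ≤ 2 * T :=
  (abs_sub _ _).trans (by linarith [abs_clamp_le hT s, abs_clamp_le hT t])

/-- Quantitative bounds for the data of the truncated problem, in which `v` is replaced by `ψ v`
in the characteristic equations. -/
structure RegularData (N P : ℝ) (f₀ : ℝ × ℝ → ℝ) (B₀ ψ : ℝ → ℝ) : Prop where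
  one_le : 1 ≤ N
  P_nonneg : 0 ≤ P
  P_le : P ≤ N
  density_le : ∀ z, |f₀ z| ≤ N
  density_lip : ∀ z z', |f₀ z - f₀ z'| ≤ N * ‖z - z'‖
  density_c1 : ∀ ε > 0, AlmostC1 ε (fun _ : Unit => f₀)
  field_le : ∀ x, |B₀ x| ≤ N
  field_lip : ∀ x y, |B₀ x - B₀ y| ≤ N * |x - y|
  field_c1 : ∀ ε > 0, AlmostC1 ε (fun _ : Unit => B₀)
  speed_le : ∀ v, |ψ v| ≤ N
  speed_lip : ∀ v w, |ψ v - ψ w| ≤ N * |v - w|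
  speed_c1 : ∀ ε > 0, AlmostC1 ε (fun _ : Unit => ψ)

theorem continuous_of_abs_sub_le {E : Type*} [SeminormedAddCommGroup E] {g : E → ℝ} {N : ℝ}
    (h : ∀ x y, |g x - g y| ≤ N * ‖x - y‖) : Continuous g :=
  (LipschitzWith.of_dist_le' (K := N) fun x y => by
    rw [dist_eq_norm, dist_eq_norm]; exact h x y).continuous

/-- The length of the time interval on which the truncated problem is solved. -/
noncomputable def shortTime (N : ℝ) : ℝ := 1 / (24 * (N + 1) ^ 2)

theorem shortTime_pos {N : ℝ} (hN : 1 ≤ N) : 0 < shortTime N := by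
  unfold shortTime; positivity

theorem shortTime_mul_sq {N : ℝ} (hN : 1 ≤ N) : shortTime N * (N + 1) ^ 2 = 1 / 24 := by
  unfold shortTime; field_simp

theorem shortTime_mul_le {N : ℝ} (hN : 1 ≤ N) : shortTime N * (N + 1) ≤ 1 / 48 := by
  have h1 := shortTime_mul_sq hN
  have h2 : 0 ≤ shortTime N * (N + 1) := mul_nonneg (shortTime_pos hN).le (by linarith)
  nlinarith

/-! ### Fixed point of the Picard map -/

section Picard

open BoundedContinuousFunction

variable {N P : ℝ} {f₀ : ℝ × ℝ → ℝ} {B₀ ψ : ℝ → ℝ}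

/-- Displacements along characteristics from time `t` to time `s`, and fields. -/
abbrev PicardSpace := ((ℝ × ℝ × ℝ × ℝ) →ᵇ (ℝ × ℝ)) × ((ℝ × ℝ) →ᵇ ℝ)

theorem RegularData.continuous_density (D : RegularData N P f₀ B₀ ψ) : Continuous f₀ :=
  continuous_of_abs_sub_le D.density_lip

theorem RegularData.continuous_field (D : RegularData N P f₀ B₀ ψ) : Continuous B₀ :=
  continuous_of_abs_sub_le D.field_lip

theorem RegularData.continuous_speed (D : RegularData N P f₀ B₀ ψ) : Continuous ψ :=
  continuous_of_abs_sub_le D.speed_lip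

theorem continuous_integral_clamp {E : Type*} [NormedAddCommGroup E] [NormedSpace ℝ E] {T : ℝ}
    {H : ℝ → ℝ × ℝ × ℝ → E} (hH : Continuous fun p : (ℝ × ℝ × ℝ) × ℝ => H p.2 p.1) :
    Continuous fun p : ℝ × ℝ × ℝ × ℝ => ∫ τ in clamp T p.2.1..clamp T p.1, H τ p.2 := by
  have h : Continuous (Function.uncurry fun (p : ℝ × ℝ × ℝ × ℝ) (τ : ℝ) => H τ p.2) :=
    hH.comp (by fun_prop : Continuous fun q : (ℝ × ℝ × ℝ × ℝ) × ℝ => (q.1.2, q.2))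
  have hi : ∀ p : ℝ × ℝ × ℝ × ℝ, ∀ a b, IntervalIntegrable (fun τ => H τ p.2)
      MeasureTheory.volume a b := fun p a b =>
    Continuous.intervalIntegrable (h.comp (by fun_prop : Continuous fun τ : ℝ => (p, τ))) _ _
  have e : (fun p : ℝ × ℝ × ℝ × ℝ => ∫ τ in clamp T p.2.1..clamp T p.1, H τ p.2) = fun p =>
      (∫ τ in (0 : ℝ)..clamp T p.1, H τ p.2) - ∫ τ in (0 : ℝ)..clamp T p.2.1, H τ p.2 := by
    funext p
    rw [intervalIntegral.integral_interval_sub_left (hi p _ _) (hi p _ _)]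
  rw [e]
  exact (intervalIntegral.continuous_parametric_intervalIntegral_of_continuous h
    (by fun_prop)).sub (intervalIntegral.continuous_parametric_intervalIntegral_of_continuous h
    (by fun_prop))

/-- The right-hand side of the characteristic equations. -/
def force (ψ : ℝ → ℝ) (B : ℝ → ℝ → ℝ) (τ : ℝ) (z : ℝ × ℝ) : ℝ × ℝ := (ψ z.2, B τ z.1)

theorem force_sub_le {K : ℝ} {B : ℝ → ℝ → ℝ} (hψ : ∀ v w, |ψ v - ψ w| ≤ K * |v - w|)
    (hK : 0 ≤ K) (hB : ∀ t x y, |B t x - B t y| ≤ K * |x - y|) (τ : ℝ) (z z' : ℝ × ℝ) :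
    ‖force ψ B τ z - force ψ B τ z'‖ ≤ K * ‖z - z'‖ := by
  refine norm_prod_le_iff.2 ⟨(hψ _ _).trans ?_, (hB _ _ _).trans ?_⟩
  · gcongr; exact norm_snd_le (z - z')
  · gcongr; exact norm_fst_le (z - z')

theorem RegularData.continuous_force (D : RegularData N P f₀ B₀ ψ) {B : ℝ → ℝ → ℝ}
    (hB : Continuous fun p : ℝ × ℝ => B p.1 p.2) :
    Continuous fun p : ℝ × ℝ × ℝ => force ψ B p.1 p.2 :=
  (D.continuous_speed.comp (by fun_prop)).prodMk
    (hB.comp (by fun_prop : Continuous fun p : ℝ × ℝ × ℝ => (p.1, p.2.1)))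

/-- The displacements produced by one Picard step. -/
noncomputable def RegularData.flowStep (D : RegularData N P f₀ B₀ ψ) (u : PicardSpace) :
    (ℝ × ℝ × ℝ × ℝ) →ᵇ (ℝ × ℝ) :=
  BoundedContinuousFunction.ofNormedAddCommGroup
    (fun p => ∫ τ in clamp (shortTime N) p.2.1..clamp (shortTime N) p.1,
      force ψ (fun t x => u.2 (t, x)) τ (p.2.2 + u.1 (τ, p.2)))
    (continuous_integral_clamp
      (H := fun τ q => force ψ (fun t x => u.2 (t, x)) τ (q.2 + u.1 (τ, q)))
      ((D.continuous_force (B := fun t x => u.2 (t, x))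
        (by fun_prop : Continuous fun p : ℝ × ℝ => u.2 (p.1, p.2))).comp
        (by fun_prop :
          Continuous fun p : (ℝ × ℝ × ℝ) × ℝ => (p.2, p.1.2 + u.1 (p.2, p.1)))))
    (max N ‖u.2‖ * (2 * shortTime N))
    (fun p => (intervalIntegral.norm_integral_le_of_norm_le_const fun τ _ =>
      norm_prod_le_iff.2 ⟨(D.speed_le _).trans (le_max_left _ _),
        (u.2.norm_coe_le_norm _).trans (le_max_right _ _)⟩).trans (by
          have := abs_clamp_sub_le (shortTime_pos D.one_le).le p.1 p.2.1
          have := D.one_le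
          gcongr))

theorem RegularData.continuous_fieldStep (D : RegularData N P f₀ B₀ ψ)
    {Z : ℝ → ℝ × ℝ → ℝ × ℝ} (hZ : Continuous fun p : ℝ × ℝ × ℝ => Z p.1 p.2) (T : ℝ) :
    Continuous fun p : ℝ × ℝ => B₀ (p.2 - clamp T p.1) + ∫ σ in (0 : ℝ)..clamp T p.1,
      ∫ w in -P..P, f₀ (Z σ (p.2 - clamp T p.1 + σ, w)) := by
  have h0 : Continuous (Function.uncurry fun (q : (ℝ × ℝ) × ℝ) (w : ℝ) =>
      f₀ (Z q.2 (q.1.2 - clamp T q.1.1 + q.2, w))) :=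
    D.continuous_density.comp (hZ.comp (by fun_prop :
      Continuous fun q : ((ℝ × ℝ) × ℝ) × ℝ => (q.1.2, q.1.1.2 - clamp T q.1.1.1 + q.1.2, q.2)))
  have h1 : Continuous (Function.uncurry fun (p : ℝ × ℝ) (σ : ℝ) =>
      ∫ w in -P..P, f₀ (Z σ (p.2 - clamp T p.1 + σ, w))) :=
    intervalIntegral.continuous_parametric_intervalIntegral_of_continuous' h0 _ _
  exact (D.continuous_field.comp (by fun_prop)).add
    (intervalIntegral.continuous_parametric_intervalIntegral_of_continuous h1 (by fun_prop))

theorem abs_double_integral_le {g : ℝ → ℝ → ℝ} {C T t : ℝ} (hP : 0 ≤ P)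
    (hC : 0 ≤ C) (ht : |t| ≤ T) (hg : ∀ σ w, |g σ w| ≤ C) :
    |∫ σ in (0 : ℝ)..t, ∫ w in -P..P, g σ w| ≤ C * (2 * P) * T := by
  have h1 : ∀ σ, ‖∫ w in -P..P, g σ w‖ ≤ C * (2 * P) := by
    intro σ
    have := intervalIntegral.norm_integral_le_of_norm_le_const (a := -P) (b := P) (f := g σ) (C := C)
      (fun w _ => hg σ w)
    rwa [sub_neg_eq_add, ← two_mul, abs_of_nonneg (by linarith)] at this
  have := intervalIntegral.norm_integral_le_of_norm_le_const (a := 0) (b := t)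
    (fun σ _ => h1 σ)
  rw [sub_zero] at this
  exact this.trans (by gcongr)

/-- The field produced by one Picard step. -/
noncomputable def RegularData.fieldStep (D : RegularData N P f₀ B₀ ψ) (u : PicardSpace) :
    (ℝ × ℝ) →ᵇ ℝ :=
  BoundedContinuousFunction.ofNormedAddCommGroup
    (fun p => B₀ (p.2 - clamp (shortTime N) p.1) + ∫ σ in (0 : ℝ)..clamp (shortTime N) p.1,
      ∫ w in -P..P, f₀ ((p.2 - clamp (shortTime N) p.1 + σ, w) +
        u.1 (0, σ, (p.2 - clamp (shortTime N) p.1 + σ, w))))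
    (D.continuous_fieldStep (Z := fun σ z => z + u.1 (0, σ, z)) (by fun_prop) _)
    (N + N * (2 * P) * shortTime N)
    (fun p => (norm_add_le _ _).trans (add_le_add (D.field_le _)
      (abs_double_integral_le D.P_nonneg (by linarith [D.one_le])
        (abs_clamp_le (shortTime_pos D.one_le).le _) fun _ _ => D.density_le _)))

/-- The Picard map of the truncated problem; its fixed points are the solutions. -/
noncomputable def RegularData.picard (D : RegularData N P f₀ B₀ ψ) (u : PicardSpace) :
    PicardSpace := (D.flowStep u, D.fieldStep u)

/-- Pairs of a flow and a field that are Lipschitz in space. -/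
def lipschitzPairs (K : ℝ) : Set PicardSpace :=
  {u | (∀ s t z z', ‖(z + u.1 (s, t, z)) - (z' + u.1 (s, t, z'))‖ ≤ 2 * ‖z - z'‖) ∧
    ∀ t x y, |u.2 (t, x) - u.2 (t, y)| ≤ K * |x - y|}

theorem isClosed_lipschitzPairs (K : ℝ) : IsClosed (lipschitzPairs K) := by
  have e1 : ∀ p, Continuous fun u : PicardSpace => u.1 p := fun p =>
    (continuous_eval_const p).comp continuous_fst
  have e2 : ∀ p, Continuous fun u : PicardSpace => u.2 p := fun p =>
    (continuous_eval_const p).comp continuous_snd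
  simp only [lipschitzPairs, ofPred_and, ofPred_forall]
  refine IsClosed.inter ?_ ?_
  · exact isClosed_iInter fun s => isClosed_iInter fun t => isClosed_iInter fun z =>
      isClosed_iInter fun z' => isClosed_le
        ((continuous_const.add (e1 _)).sub (continuous_const.add (e1 _))).norm continuous_const
  · exact isClosed_iInter fun t => isClosed_iInter fun x => isClosed_iInter fun y =>
      isClosed_le ((e2 _).sub (e2 _)).abs continuous_const

theorem RegularData.force_lip (D : RegularData N P f₀ B₀ ψ) {B : ℝ → ℝ → ℝ}
    (hB : ∀ t x y, |B t x - B t y| ≤ (N + 1) * |x - y|) (τ : ℝ) (z z' : ℝ × ℝ) :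
    ‖force ψ B τ z - force ψ B τ z'‖ ≤ (N + 1) * ‖z - z'‖ := by
  have := D.one_le
  refine force_sub_le (fun v w => (D.speed_lip v w).trans ?_) (by linarith) hB τ z z'
  gcongr
  linarith

theorem RegularData.integrable_force (D : RegularData N P f₀ B₀ ψ) (u : PicardSpace) (t : ℝ)
    (z : ℝ × ℝ) (a b : ℝ) : IntervalIntegrable
      (fun τ => force ψ (fun t x => u.2 (t, x)) τ (z + u.1 (τ, t, z))) MeasureTheory.volume a b :=
  Continuous.intervalIntegrable
    ((D.continuous_force (B := fun t x => u.2 (t, x))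
        (by fun_prop : Continuous fun p : ℝ × ℝ => u.2 (p.1, p.2))).comp
      (by fun_prop : Continuous fun τ : ℝ => (τ, z + u.1 (τ, t, z)))) _ _

theorem RegularData.continuous_inner (D : RegularData N P f₀ B₀ ψ) (u : PicardSpace) (a : ℝ) :
    Continuous fun q : ℝ × ℝ => f₀ ((a + q.1, q.2) + u.1 (0, q.1, (a + q.1, q.2))) :=
  D.continuous_density.comp (by fun_prop)

theorem RegularData.double_integral_sub (D : RegularData N P f₀ B₀ ψ) (u u' : PicardSpace)
    (a a' t : ℝ) :
    (∫ σ in (0 : ℝ)..t, ∫ w in -P..P, f₀ ((a + σ, w) + u.1 (0, σ, (a + σ, w)))) -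
      (∫ σ in (0 : ℝ)..t, ∫ w in -P..P, f₀ ((a' + σ, w) + u'.1 (0, σ, (a' + σ, w)))) =
    ∫ σ in (0 : ℝ)..t, ∫ w in -P..P, (f₀ ((a + σ, w) + u.1 (0, σ, (a + σ, w))) -
      f₀ ((a' + σ, w) + u'.1 (0, σ, (a' + σ, w)))) := by
  have h1 : ∀ (u : PicardSpace) (a : ℝ), IntervalIntegrable
      (fun σ => ∫ w in -P..P, f₀ ((a + σ, w) + u.1 (0, σ, (a + σ, w))))
      MeasureTheory.volume 0 t := fun u a =>
    (intervalIntegral.continuous_parametric_intervalIntegral_of_continuous'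
      (f := fun σ w => f₀ ((a + σ, w) + u.1 (0, σ, (a + σ, w))))
      (D.continuous_inner u a) _ _).intervalIntegrable _ _
  rw [← intervalIntegral.integral_sub (h1 u a) (h1 u' a')]
  congr 1
  funext σ
  rw [← intervalIntegral.integral_sub]
  · exact ((D.continuous_inner u a).comp
      (by fun_prop : Continuous fun w : ℝ => (σ, w))).intervalIntegrable _ _
  · exact ((D.continuous_inner u' a').comp
      (by fun_prop : Continuous fun w : ℝ => (σ, w))).intervalIntegrable _ _

/-- The identity contributes 1 to the Lipschitz constant of the flow and B₀ contributes N to that of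
the field. The short time leaves at most 1 for each of the integral terms, which gives 2 and N + 1.
-/
theorem RegularData.picard_mapsTo (D : RegularData N P f₀ B₀ ψ) :
    MapsTo D.picard (lipschitzPairs (N + 1)) (lipschitzPairs (N + 1)) := by
  intro u hu
  have hN := D.one_le
  have hP := D.P_nonneg
  have hPN := D.P_le
  have hT := shortTime_pos hN
  have hT1 := shortTime_mul_le hN
  have hT2 := shortTime_mul_sq hN
  refine ⟨fun s t z z' => ?_, fun t x y => ?_⟩
  · change ‖(z + ∫ τ in clamp (shortTime N) t..clamp (shortTime N) s,
        force ψ (fun t x => u.2 (t, x)) τ (z + u.1 (τ, t, z))) -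
        (z' + ∫ τ in clamp (shortTime N) t..clamp (shortTime N) s,
        force ψ (fun t x => u.2 (t, x)) τ (z' + u.1 (τ, t, z')))‖ ≤ _
    rw [add_sub_add_comm,
      ← intervalIntegral.integral_sub (D.integrable_force _ _ _ _ _) (D.integrable_force _ _ _ _ _)]
    have h1 := intervalIntegral.norm_integral_le_of_norm_le_const
      (a := clamp (shortTime N) t) (b := clamp (shortTime N) s)
      (f := fun τ => force ψ (fun t x => u.2 (t, x)) τ (z + u.1 (τ, t, z)) -
        force ψ (fun t x => u.2 (t, x)) τ (z' + u.1 (τ, t, z')))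
      (C := (N + 1) * (2 * ‖z - z'‖)) fun τ _ => (D.force_lip hu.2 _ _ _).trans (by
        gcongr
        exact hu.1 τ t z z')
    have h2 : (N + 1) * (2 * ‖z - z'‖) * |clamp (shortTime N) s - clamp (shortTime N) t|
        ≤ (N + 1) * (2 * ‖z - z'‖) * (2 * shortTime N) := by
      gcongr
      exact abs_clamp_sub_le hT.le _ _
    have h3 : (N + 1) * (2 * ‖z - z'‖) * (2 * shortTime N) ≤ ‖z - z'‖ := by
      have := norm_nonneg (z - z')
      nlinarith
    exact (norm_add_le _ _).trans (by linarith)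
  · change |(B₀ (x - clamp (shortTime N) t) + _) - (B₀ (y - clamp (shortTime N) t) + _)| ≤ _
    rw [add_sub_add_comm, D.double_integral_sub]
    have h1 := D.field_lip (x - clamp (shortTime N) t) (y - clamp (shortTime N) t)
    rw [sub_sub_sub_cancel_right] at h1
    have h2 := abs_double_integral_le (P := P) (C := N * (2 * |x - y|))
      (g := fun σ w => f₀ ((x - clamp (shortTime N) t + σ, w) +
        u.1 (0, σ, (x - clamp (shortTime N) t + σ, w))) -
        f₀ ((y - clamp (shortTime N) t + σ, w) + u.1 (0, σ, (y - clamp (shortTime N) t + σ, w))))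
      hP (by positivity) (abs_clamp_le hT.le t) fun σ w => by
        refine (D.density_lip _ _).trans ?_
        have := hu.1 0 σ (x - clamp (shortTime N) t + σ, w) (y - clamp (shortTime N) t + σ, w)
        rw [show ((x - clamp (shortTime N) t + σ, w) - (y - clamp (shortTime N) t + σ, w) : ℝ × ℝ)
          = (x - y, 0) by ext <;> simp] at this
        rw [Prod.norm_mk (x - y), norm_zero, max_eq_left (norm_nonneg _), Real.norm_eq_abs] at this
        gcongr
    have h3 : N * (2 * |x - y|) * (2 * P) * shortTime N ≤ |x - y| := by
      have h5 : N * P ≤ (N + 1) ^ 2 := by nlinarith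
      have h6 : N * P * shortTime N ≤ 1 / 24 := by
        rw [← hT2, mul_comm]; gcongr
      have := abs_nonneg (x - y)
      nlinarith
    exact (abs_add_le _ _).trans (by linarith)

/-- Only one of the two pairs has to be Lipschitz. The force is first compared at two flow points
within the field of `u`, and then the fields are compared at the same point. In the field component
the Lipschitz bound of f₀ is enough. -/
theorem RegularData.dist_picard_le (D : RegularData N P f₀ B₀ ψ) {u u' : PicardSpace}
    (hu : u ∈ lipschitzPairs (N + 1)) :
    dist (D.picard u) (D.picard u') ≤ 1 / 2 * dist u u' := by
  have hN := D.one_le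
  have hP := D.P_nonneg
  have hPN := D.P_le
  have hT := shortTime_pos hN
  have hT1 := shortTime_mul_le hN
  have hT2 := shortTime_mul_sq hN
  have hd := dist_nonneg (x := u) (y := u')
  have d1 : ∀ p, ‖u.1 p - u'.1 p‖ ≤ dist u u' := fun p => by
    rw [← dist_eq_norm]
    exact (BoundedContinuousFunction.dist_coe_le_dist p).trans (le_max_left _ _)
  have d2 : ∀ p, |u.2 p - u'.2 p| ≤ dist u u' := fun p => by
    rw [← Real.dist_eq]
    exact (BoundedContinuousFunction.dist_coe_le_dist p).trans (le_max_right _ _)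
  refine max_le ((BoundedContinuousFunction.dist_le (by positivity)).2 ?_)
    ((BoundedContinuousFunction.dist_le (by positivity)).2 ?_)
  · rintro ⟨s, t, z⟩
    change dist (∫ τ in clamp (shortTime N) t..clamp (shortTime N) s,
        force ψ (fun t x => u.2 (t, x)) τ (z + u.1 (τ, t, z)))
        (∫ τ in clamp (shortTime N) t..clamp (shortTime N) s,
        force ψ (fun t x => u'.2 (t, x)) τ (z + u'.1 (τ, t, z))) ≤ _
    rw [dist_eq_norm,
      ← intervalIntegral.integral_sub (D.integrable_force _ _ _ _ _) (D.integrable_force _ _ _ _ _)]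
    have h1 := intervalIntegral.norm_integral_le_of_norm_le_const
      (a := clamp (shortTime N) t) (b := clamp (shortTime N) s)
      (f := fun τ => force ψ (fun t x => u.2 (t, x)) τ (z + u.1 (τ, t, z)) -
        force ψ (fun t x => u'.2 (t, x)) τ (z + u'.1 (τ, t, z)))
      (C := (N + 1) * dist u u' + dist u u') fun τ _ => by
        refine (norm_sub_le_norm_sub_add_norm_sub _
          (force ψ (fun t x => u.2 (t, x)) τ (z + u'.1 (τ, t, z))) _).trans (add_le_add ?_ ?_)
        · refine (D.force_lip hu.2 _ _ _).trans ?_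
          rw [add_sub_add_left_eq_sub]
          gcongr
          exact d1 _
        · refine norm_prod_le_iff.2 ⟨?_, ?_⟩
          · simp [force, hd]
          · exact d2 _
    have h2 : ((N + 1) * dist u u' + dist u u') * |clamp (shortTime N) s - clamp (shortTime N) t|
        ≤ ((N + 1) * dist u u' + dist u u') * (2 * shortTime N) := by
      gcongr
      exact abs_clamp_sub_le hT.le _ _
    refine h1.trans (h2.trans ?_)
    nlinarith
  · rintro ⟨t, x⟩
    change dist (B₀ (x - clamp (shortTime N) t) + _) (B₀ (x - clamp (shortTime N) t) + _) ≤ _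
    rw [dist_add_left, Real.dist_eq, D.double_integral_sub]
    refine (abs_double_integral_le (P := P) (C := N * dist u u') hP (by positivity)
      (abs_clamp_le hT.le t) fun σ w => ?_).trans ?_
    · refine (D.density_lip _ _).trans ?_
      rw [add_sub_add_left_eq_sub]
      gcongr
      exact d1 _
    · have h5 : N * P ≤ (N + 1) ^ 2 := by nlinarith
      have h6 : N * P * shortTime N ≤ 1 / 24 := by
        rw [← hT2, mul_comm]; gcongr
      nlinarith

/-- The flow `Z s t` from time `t` to time `s` and the field `B` solve the truncated problem in
integrated form, with times clamped to `[-T, T]`, `T = shortTime N`. -/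
structure IsTruncatedSolution (N P : ℝ) (f₀ : ℝ × ℝ → ℝ) (B₀ ψ : ℝ → ℝ)
    (Z : ℝ → ℝ → ℝ × ℝ → ℝ × ℝ) (B : ℝ → ℝ → ℝ) : Prop where
  continuous_flow : Continuous fun p : ℝ × ℝ × ℝ × ℝ => Z p.1 p.2.1 p.2.2
  continuous_field : Continuous fun p : ℝ × ℝ => B p.1 p.2
  flow_lip : ∀ s t z z', ‖Z s t z - Z s t z'‖ ≤ 2 * ‖z - z'‖
  field_lip : ∀ t x y, |B t x - B t y| ≤ (N + 1) * |x - y|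
  flow_eq : ∀ s t z, Z s t z = z + ∫ τ in clamp (shortTime N) t..clamp (shortTime N) s,
    force ψ B τ (Z τ t z)
  field_eq : ∀ t x, B t x = B₀ (x - clamp (shortTime N) t) +
    ∫ σ in (0 : ℝ)..clamp (shortTime N) t,
      ∫ w in -P..P, f₀ (Z 0 σ (x - clamp (shortTime N) t + σ, w))

theorem RegularData.exists_truncatedSolution (D : RegularData N P f₀ B₀ ψ) :
    ∃ Z B, IsTruncatedSolution N P f₀ B₀ ψ Z B := by
  have hS := (isClosed_lipschitzPairs (N + 1)).isComplete
  have h0 : (0 : PicardSpace) ∈ lipschitzPairs (N + 1) := by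
    refine ⟨fun s t z z' => ?_, fun t x y => ?_⟩
    · simp only [Prod.fst_zero, BoundedContinuousFunction.coe_zero, Pi.zero_apply, add_zero]
      linarith [norm_nonneg (z - z')]
    · have := D.one_le
      simp only [Prod.snd_zero, BoundedContinuousFunction.coe_zero, Pi.zero_apply, sub_zero,
        abs_zero]
      positivity
  have hc : ContractingWith (1 / 2) (D.picard_mapsTo.restrict D.picard _ _) := by
    refine ⟨by rw [← NNReal.coe_lt_coe]; push_cast; norm_num, LipschitzWith.of_dist_le_mul ?_⟩
    rintro ⟨u, hu⟩ ⟨u', hu'⟩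
    have := D.dist_picard_le (u' := u') hu
    push_cast
    exact this
  obtain ⟨u, hu, hfix, -⟩ := hc.exists_fixedPoint' hS D.picard_mapsTo h0 (edist_ne_top _ _)
  have h1 : D.flowStep u = u.1 := congrArg Prod.fst hfix
  have h2 : D.fieldStep u = u.2 := congrArg Prod.snd hfix
  refine ⟨fun s t z => z + u.1 (s, t, z), fun t x => u.2 (t, x), by fun_prop, by fun_prop, hu.1,
    hu.2, fun s t z => ?_, fun t x => ?_⟩
  · have := DFunLike.congr_fun h1 (s, t, z)
    exact congrArg (z + ·) this.symm
  · exact (DFunLike.congr_fun h2 (t, x)).symm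

end Picard

/-! ### Two differentiation lemmas -/

/-- The interval is empty at r = t, so the dependence of the integrand on r contributes only to
higher order, and mere continuity suffices. This yields the derivative of the flow with respect to
its initial time, on the diagonal. -/
theorem hasDerivAt_integral_left_diag {E : Type*} [NormedAddCommGroup E] [NormedSpace ℝ E]
    [CompleteSpace E] {H : ℝ → ℝ → E} (hH : Continuous fun p : ℝ × ℝ => H p.1 p.2) (t : ℝ) :
    HasDerivAt (fun r => ∫ τ in r..t, H τ r) (-H t t) t := by
  rw [hasDerivAt_iff_isLittleO, Asymptotics.isLittleO_iff]
  intro ε hε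
  obtain ⟨δ, hδ, hd⟩ := Metric.continuousAt_iff.1 (hH.continuousAt (x := (t, t))) ε hε
  filter_upwards [Metric.ball_mem_nhds t hδ] with r hr
  have hi : IntervalIntegrable (fun τ => H τ r) MeasureTheory.volume r t :=
    (hH.comp (by fun_prop : Continuous fun τ : ℝ => (τ, r))).intervalIntegrable _ _
  have e : (∫ τ in r..t, H τ r) - (∫ τ in t..t, H τ t) - (r - t) • -H t t =
      ∫ τ in r..t, (H τ r - H t t) := by
    rw [intervalIntegral.integral_sub hi (by simp), intervalIntegral.integral_const,
      intervalIntegral.integral_same, sub_zero, smul_neg, ← neg_smul, neg_sub]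
  rw [e]
  have := intervalIntegral.norm_integral_le_of_norm_le_const (a := r) (b := t)
    (f := fun τ => H τ r - H t t) (C := ε) fun τ hτ => by
      rw [← dist_eq_norm]
      refine (hd (x := (τ, r)) ?_).le
      rw [Prod.dist_eq]
      refine max_lt ?_ hr
      have h1 : |τ - t| ≤ |r - t| := by
        rcases uIoc_subset_uIcc hτ with ⟨h1, h2⟩
        rcases le_total r t with h | h
        · rw [min_eq_left h] at h1; rw [max_eq_right h] at h2
          rw [abs_of_nonpos (by linarith), abs_of_nonpos (by linarith)]; linarith
        · rw [min_eq_right h] at h1; rw [max_eq_left h] at h2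
          rw [abs_of_nonneg (by linarith), abs_of_nonneg (by linarith)]; linarith
      rw [Real.dist_eq]
      rw [Metric.mem_ball, Real.dist_eq] at hr
      linarith
  rw [abs_sub_comm] at this
  exact this

theorem contDiffOn_of_partial {E : Type*} [NormedAddCommGroup E] [NormedSpace ℝ E]
    {F g : ℝ → E → ℝ} {A : ℝ → E → E →L[ℝ] ℝ} {U : Set ℝ} (hU : IsOpen U)
    (h₁ : ∀ t ∈ U, ∀ z, HasDerivAt (fun s => F s z) (g t z) t)
    (h₂ : ∀ t ∈ U, ∀ z, HasFDerivAt (F t) (A t z) z)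
    (hg : Continuous fun p : ℝ × E => g p.1 p.2) (hA : Continuous fun p : ℝ × E => A p.1 p.2) :
    ContDiffOn ℝ 1 (fun p : ℝ × E => F p.1 p.2) (U ×ˢ univ) := by
  have hO : IsOpen (U ×ˢ (univ : Set E)) := hU.prod isOpen_univ
  have hg' : Continuous fun p : ℝ × E => ContinuousLinearMap.toSpanSingleton ℝ (g p.1 p.2) :=
    (ContinuousLinearMap.toSpanSingletonCLE (𝕜 := ℝ) (E := ℝ)).continuous.comp hg
  have key : ∀ p ∈ U ×ˢ (univ : Set E), HasFDerivAt (fun p : ℝ × E => F p.1 p.2)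
      ((ContinuousLinearMap.toSpanSingleton ℝ (g p.1 p.2)).coprod (A p.1 p.2)) p := by
    intro p hp
    have hev : ∀ᶠ q in 𝓝 p, q.1 ∈ U := by
      filter_upwards [hO.mem_nhds hp] with q hq using hq.1
    exact (hasStrictFDerivAt_uncurry_coprod (u := p) (f := F)
      (f₁ := fun t z => ContinuousLinearMap.toSpanSingleton ℝ (g t z)) (f₂ := A)
      (hev.mono fun q hq => (h₁ q.1 hq q.2).hasFDerivAt)
      (hev.mono fun q hq => h₂ q.1 hq q.2) hg'.continuousAt hA.continuousAt).hasFDerivAt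
  have hc : Continuous fun p : ℝ × E =>
      (ContinuousLinearMap.toSpanSingleton ℝ (g p.1 p.2)).coprod (A p.1 p.2) := by
    have e : (fun p : ℝ × E =>
        (ContinuousLinearMap.toSpanSingleton ℝ (g p.1 p.2)).coprod (A p.1 p.2)) = fun p =>
        (ContinuousLinearMap.toSpanSingleton ℝ (g p.1 p.2)).comp (ContinuousLinearMap.fst ℝ ℝ E) +
          (A p.1 p.2).comp (ContinuousLinearMap.snd ℝ ℝ E) := by
      funext p; ext <;> simp
    rw [e]
    exact (hg'.clm_comp continuous_const).add (hA.clm_comp continuous_const)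
  rw [show (1 : WithTop ℕ∞) = 0 + 1 by simp, contDiffOn_succ_iff_fderiv_of_isOpen hO]
  refine ⟨fun p hp => (key p hp).differentiableAt.differentiableWithinAt, by simp, ?_⟩
  rw [contDiffOn_zero]
  exact hc.continuousOn.congr fun p hp => (key p hp).fderiv

/-! ### Self-improving regularity of the truncated solution -/

section Truncated

variable {N P : ℝ} {f₀ : ℝ × ℝ → ℝ} {B₀ ψ : ℝ → ℝ} {Z : ℝ → ℝ → ℝ × ℝ → ℝ × ℝ} {B : ℝ → ℝ → ℝ}

theorem RegularData.mul_shortTime_le (D : RegularData N P f₀ B₀ ψ) :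
    N * P * shortTime N ≤ 1 / 24 := by
  have hN := D.one_le
  have hP := D.P_nonneg
  have hPN := D.P_le
  have h5 : N * P ≤ (N + 1) ^ 2 := by nlinarith
  rw [← shortTime_mul_sq hN, mul_comm]
  have := (shortTime_pos hN).le
  gcongr

theorem IsTruncatedSolution.abs_field_le (S : IsTruncatedSolution N P f₀ B₀ ψ Z B)
    (D : RegularData N P f₀ B₀ ψ) (t x : ℝ) : |B t x| ≤ N + 1 := by
  have hN := D.one_le
  rw [S.field_eq]
  have h1 := abs_double_integral_le D.P_nonneg (C := N) (by linarith)
    (abs_clamp_le (shortTime_pos hN).le t) (g := fun σ w =>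
      f₀ (Z 0 σ (x - clamp (shortTime N) t + σ, w))) fun _ _ => D.density_le _
  have h2 := D.mul_shortTime_le
  exact (abs_add_le _ _).trans (by linarith [D.field_le (x - clamp (shortTime N) t)])

theorem IsTruncatedSolution.norm_flow_sub_le (S : IsTruncatedSolution N P f₀ B₀ ψ Z B)
    (D : RegularData N P f₀ B₀ ψ) (s t : ℝ) (z : ℝ × ℝ) : ‖Z s t z - z‖ ≤ 1 := by
  have hN := D.one_le
  rw [S.flow_eq, add_sub_cancel_left]
  refine (intervalIntegral.norm_integral_le_of_norm_le_const (C := N + 1) fun τ _ =>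
    norm_prod_le_iff.2 ⟨(D.speed_le _).trans (by linarith), S.abs_field_le D _ _⟩).trans ?_
  have h1 := abs_clamp_sub_le (shortTime_pos hN).le s t
  have h2 := shortTime_mul_le hN
  calc _ ≤ (N + 1) * (2 * shortTime N) := by gcongr
    _ ≤ 1 := by linarith

theorem IsTruncatedSolution.continuous_force_flow (S : IsTruncatedSolution N P f₀ B₀ ψ Z B)
    (D : RegularData N P f₀ B₀ ψ) :
    Continuous fun p : ℝ × ℝ × ℝ × ℝ => force ψ B p.1 (Z p.1 p.2.1 p.2.2) :=
  (D.continuous_force S.continuous_field).comp (continuous_fst.prodMk S.continuous_flow)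

theorem IsTruncatedSolution.intervalIntegrable_force (S : IsTruncatedSolution N P f₀ B₀ ψ Z B)
    (D : RegularData N P f₀ B₀ ψ) (t : ℝ) (z : ℝ × ℝ) (a b : ℝ) :
    IntervalIntegrable (fun τ => force ψ B τ (Z τ t z)) MeasureTheory.volume a b :=
  ((S.continuous_force_flow D).comp
    (by fun_prop : Continuous fun τ : ℝ => (τ, t, z))).intervalIntegrable _ _

theorem IsTruncatedSolution.flow_self (S : IsTruncatedSolution N P f₀ B₀ ψ Z B) (t : ℝ)
    (z : ℝ × ℝ) : Z t t z = z := by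
  rw [S.flow_eq, intervalIntegral.integral_same, add_zero]

/-- As functions of the final time, both sides satisfy the same integral equation started from Z(s,
t, z). They stay within bounded distance, and the short time makes any bound for their distance
improve by a factor of two. -/
theorem IsTruncatedSolution.flow_flow (S : IsTruncatedSolution N P f₀ B₀ ψ Z B)
    (D : RegularData N P f₀ B₀ ψ) (r s t : ℝ) (z : ℝ × ℝ) : Z r s (Z s t z) = Z r t z := by
  have hN := D.one_le
  set y := Z s t z with hy
  have hdiff : ∀ τ, Z τ s y - Z τ t z = ∫ σ in clamp (shortTime N) s..clamp (shortTime N) τ,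
      (force ψ B σ (Z σ s y) - force ψ B σ (Z σ t z)) := by
    intro τ
    rw [intervalIntegral.integral_sub (S.intervalIntegrable_force D _ _ _ _)
      (S.intervalIntegrable_force D _ _ _ _), S.flow_eq τ s y, S.flow_eq τ t z, hy,
      S.flow_eq s t z, ← intervalIntegral.integral_add_adjacent_intervals
        (S.intervalIntegrable_force D t z (clamp (shortTime N) t) (clamp (shortTime N) s))
        (S.intervalIntegrable_force D t z (clamp (shortTime N) s) (clamp (shortTime N) τ))]
    abel
  have h0 := le_of_halving (u := fun τ => ‖Z τ s y - Z τ t z‖) le_rfl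
    ⟨1 + ‖y - z‖ + 1, by
      rintro _ ⟨τ, rfl⟩
      calc ‖Z τ s y - Z τ t z‖ = ‖(Z τ s y - y) + (y - z) - (Z τ t z - z)‖ := by congr 1; abel
        _ ≤ ‖Z τ s y - y‖ + ‖y - z‖ + ‖Z τ t z - z‖ :=
          (norm_sub_le _ _).trans (add_le_add_left (norm_add_le _ _) _)
        _ ≤ _ := by linarith [S.norm_flow_sub_le D τ s y, S.norm_flow_sub_le D τ t z]⟩
    (fun A hA hAb τ => by
      have h1 := intervalIntegral.norm_integral_le_of_norm_le_const
        (a := clamp (shortTime N) s) (b := clamp (shortTime N) τ)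
        (f := fun σ => force ψ B σ (Z σ s y) - force ψ B σ (Z σ t z)) (C := (N + 1) * A)
        fun σ _ => (D.force_lip S.field_lip _ _ _).trans (by gcongr; exact hAb σ)
      have h2 := abs_clamp_sub_le (shortTime_pos hN).le τ s
      have h3 := shortTime_mul_le hN
      simp only [hdiff τ]
      calc _ ≤ (N + 1) * A * |clamp (shortTime N) τ - clamp (shortTime N) s| := h1
        _ ≤ (N + 1) * A * (2 * shortTime N) := by gcongr
        _ ≤ 0 + A / 2 := by nlinarith) r
  rw [mul_zero] at h0
  exact sub_eq_zero.1 (norm_le_zero_iff.1 h0)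

/-- In the integral equations every occurrence of Z and B on the right sits under a time integral,
and the identity has zero second difference. The composition rule multiplies ε by a constant of
order N, and the short integration interval makes the outcome less than ε/2. -/
theorem IsTruncatedSolution.almostC1_half (S : IsTruncatedSolution N P f₀ B₀ ψ Z B)
    (D : RegularData N P f₀ B₀ ψ) {ε : ℝ} (hε : 0 < ε)
    (hZ : AlmostC1 ε (fun (p : ℝ × ℝ) z => Z p.1 p.2 z)) (hB : AlmostC1 ε B) :
    AlmostC1 (ε / 2) (fun (p : ℝ × ℝ) z => Z p.1 p.2 z) ∧ AlmostC1 (ε / 2) B := by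
  have hN := D.one_le
  have hP := D.P_nonneg
  have hPN := D.P_le
  have hT := (shortTime_pos hN).le
  have hT1 := shortTime_mul_le hN
  have hT2 := D.mul_shortTime_le
  have hT3 := shortTime_mul_sq hN
  constructor
  · have a1 : AlmostC1 ε (fun (_ : ℝ) (z : ℝ × ℝ) => ψ z.2) :=
      (D.speed_c1 ε hε).comp_affine hε.le (fun _ : ℝ => ()) (fun _ z => z.2) (fun z : ℝ × ℝ => z.2)
        norm_snd_le (fun _ _ _ => rfl)
    have a2 : AlmostC1 ε (fun (τ : ℝ) (z : ℝ × ℝ) => B τ z.1) :=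
      hB.comp_affine hε.le (fun τ : ℝ => τ) (fun _ z => z.1) (fun z : ℝ × ℝ => z.1)
        norm_fst_le (fun _ _ _ => rfl)
    have h1 : AlmostC1 ε (fun τ z => force ψ B τ z) := a1.prodMk a2
    have h2 : AlmostC1 (2 * ε + (N + 1) * ε)
        (fun (k : (ℝ × ℝ) × ℝ) z => force ψ B k.2 (Z k.2 k.1.2 z)) :=
      h1.comp (D.force_lip S.field_lip) (by linarith) hε.le (hZ.reindex fun k => (k.2, k.1.2))
        (fun k => S.flow_lip _ _) (fun k : (ℝ × ℝ) × ℝ => k.2)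
    have h3 := AlmostC1.integral (κ := ℝ × ℝ) (H := fun k τ z => force ψ B τ (Z τ k.2 z))
      (by positivity) h2
      (fun k z => (S.continuous_force_flow D).comp (by fun_prop : Continuous fun τ : ℝ => (τ, k.2, z)))
      (fun k => clamp (shortTime N) k.2) (fun k => clamp (shortTime N) k.1)
      (fun k => abs_clamp_sub_le hT _ _)
    have h4 : AlmostC1 0 (fun (_ : ℝ × ℝ) (z : ℝ × ℝ) => z) :=
      ⟨1, one_pos, fun i z z' h _ _ => by simp⟩
    have h5 := h4.add h3
    simp only [← S.flow_eq] at h5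
    refine h5.mono ?_
    nlinarith
  · have h1 : AlmostC1 (2 * ε + N * ε) (fun (σ : ℝ) z => f₀ (Z 0 σ z)) :=
      (D.density_c1 ε hε).comp (fun _ => D.density_lip) (by linarith) hε.le
        (hZ.reindex fun σ => (0, σ)) (fun k => S.flow_lip _ _) (fun _ => ())
    have h2 : AlmostC1 (2 * ε + N * ε) (fun (k : (ℝ × ℝ) × ℝ) (x : ℝ) =>
        f₀ (Z 0 k.1.2 (x - clamp (shortTime N) k.1.1 + k.1.2, k.2))) :=
      h1.comp_affine (by positivity) (fun k : (ℝ × ℝ) × ℝ => k.1.2)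
        (fun k x => (x - clamp (shortTime N) k.1.1 + k.1.2, k.2)) (fun x : ℝ => (x, 0))
        (fun x => by simp [Prod.norm_def]) (fun k x y => by ext <;> simp; ring)
    have hc : Continuous fun q : ((ℝ × ℝ) × ℝ) × ℝ =>
        f₀ (Z 0 q.1.1.2 (q.2 - clamp (shortTime N) q.1.1.1 + q.1.1.2, q.1.2)) :=
      D.continuous_density.comp (S.continuous_flow.comp (by fun_prop : Continuous
        fun q : ((ℝ × ℝ) × ℝ) × ℝ =>
          ((0 : ℝ), q.1.1.2, (q.2 - clamp (shortTime N) q.1.1.1 + q.1.1.2, q.1.2))))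
    have h3 := AlmostC1.integral (κ := ℝ × ℝ) (H := fun k w x =>
        f₀ (Z 0 k.2 (x - clamp (shortTime N) k.1 + k.2, w))) (by positivity) h2
      (fun k x => hc.comp (by fun_prop : Continuous fun w : ℝ => ((k, w), x)))
      (fun _ => -P) (fun _ => P) (l := 2 * P)
      (fun k => by rw [sub_neg_eq_add, ← two_mul, abs_of_nonneg (by linarith)])
    have h4 := AlmostC1.integral (κ := ℝ) (H := fun t σ x => ∫ w in -P..P,
        f₀ (Z 0 σ (x - clamp (shortTime N) t + σ, w))) (by positivity) h3
      (fun t x => intervalIntegral.continuous_parametric_intervalIntegral_of_continuous'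
        (f := fun σ w => f₀ (Z 0 σ (x - clamp (shortTime N) t + σ, w)))
        (hc.comp (by fun_prop : Continuous fun q : ℝ × ℝ => (((t, q.1), q.2), x))) _ _)
      (fun _ => 0) (fun t => clamp (shortTime N) t) (l := shortTime N)
      (fun t => by rw [sub_zero]; exact abs_clamp_le hT t)
    -- The B₀ term carries no small time factor. Being C¹ with compact support or otherwise regular
    -- by assumption, it can be given ε/4 directly, which leaves ε/4 for the integral.
    have h5 : AlmostC1 (ε / 4) (fun (t : ℝ) x => B₀ (x - clamp (shortTime N) t)) :=
      (D.field_c1 (ε / 4) (by positivity)).comp_affine (by positivity) (fun _ => ())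
        (fun t x => x - clamp (shortTime N) t) (fun x => x) (fun x => le_rfl)
        (fun k x y => by ring)
    have h6 := h5.add h4
    have e : B = fun t x => B₀ (x - clamp (shortTime N) t) +
        ∫ σ in (0 : ℝ)..clamp (shortTime N) t, ∫ w in -P..P,
          f₀ (Z 0 σ (x - clamp (shortTime N) t + σ, w)) := by
      funext t x; exact S.field_eq t x
    rw [e]
    refine h6.mono ?_
    have : P * shortTime N ≤ 1 / 48 := by
      refine le_trans ?_ hT1
      rw [mul_comm]; gcongr; linarith
    have h7 : shortTime N * (2 * P * (2 * ε + N * ε)) =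
        (4 * (P * shortTime N) + 2 * (N * P * shortTime N)) * ε := by ring
    rw [h7]
    nlinarith

/-- The Lipschitz bounds give the condition with 2(N + 1) for both functions, and repeated halving
brings this below any ε. -/
theorem IsTruncatedSolution.almostC1 (S : IsTruncatedSolution N P f₀ B₀ ψ Z B)
    (D : RegularData N P f₀ B₀ ψ) {ε : ℝ} (hε : 0 < ε) :
    AlmostC1 ε (fun (p : ℝ × ℝ) z => Z p.1 p.2 z) ∧ AlmostC1 ε B := by
  have hN := D.one_le
  have key : ∀ n : ℕ, AlmostC1 (2 * (N + 1) / 2 ^ n) (fun (p : ℝ × ℝ) z => Z p.1 p.2 z) ∧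
      AlmostC1 (2 * (N + 1) / 2 ^ n) B := by
    intro n
    induction n with
    | zero =>
      rw [pow_zero, div_one]
      exact ⟨(AlmostC1.of_lipschitz fun p => S.flow_lip p.1 p.2).mono (by linarith),
        AlmostC1.of_lipschitz S.field_lip⟩
    | succ n ih =>
      rw [pow_succ, ← div_div]
      exact S.almostC1_half D (by positivity) ih.1 ih.2
  obtain ⟨n, hn⟩ := exists_pow_lt_of_lt_one (show 0 < ε / (2 * (N + 1)) by positivity)
    (show (1 / 2 : ℝ) < 1 by norm_num)
  have hle : 2 * (N + 1) / 2 ^ n ≤ ε := by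
    rw [lt_div_iff₀ (by positivity), one_div, inv_pow, ← div_eq_inv_mul] at hn
    exact hn.le
  exact ⟨(key n).1.mono hle, (key n).2.mono hle⟩

end Truncated

/-! ### Differential equations satisfied by the truncated solution -/

section Truncated

variable {N P : ℝ} {f₀ : ℝ × ℝ → ℝ} {B₀ ψ : ℝ → ℝ} {Z : ℝ → ℝ → ℝ × ℝ → ℝ × ℝ} {B : ℝ → ℝ → ℝ}

theorem IsTruncatedSolution.continuous_density (S : IsTruncatedSolution N P f₀ B₀ ψ Z B)
    (D : RegularData N P f₀ B₀ ψ) : Continuous fun p : ℝ × ℝ × ℝ => f₀ (Z 0 p.1 p.2) :=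
  D.continuous_density.comp (S.continuous_flow.comp
    (by fun_prop : Continuous fun p : ℝ × ℝ × ℝ => ((0 : ℝ), p.1, p.2)))

theorem IsTruncatedSolution.almostC1_density (S : IsTruncatedSolution N P f₀ B₀ ψ Z B)
    (D : RegularData N P f₀ B₀ ψ) {ε : ℝ} (hε : 0 < ε) :
    AlmostC1 ε (fun (t : ℝ) z => f₀ (Z 0 t z)) := by
  have hN := D.one_le
  have hε' : 0 < ε / (2 + N) := by positivity
  refine AlmostC1.mono ((D.density_c1 _ hε').comp (fun _ => D.density_lip) (by linarith) hε'.le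
    ((S.almostC1 D hε').1.reindex fun t : ℝ => (0, t)) (fun k => S.flow_lip _ _) (fun _ => ()))
    (le_of_eq ?_)
  field_simp

theorem IsTruncatedSolution.differentiable_density (S : IsTruncatedSolution N P f₀ B₀ ψ Z B)
    (D : RegularData N P f₀ B₀ ψ) (t : ℝ) : Differentiable ℝ fun z => f₀ (Z 0 t z) := by
  have hN := D.one_le
  refine AlmostC1.differentiable (L := (N * 2).toNNReal) (F := fun (t : ℝ) z => f₀ (Z 0 t z))
    (fun t => LipschitzWith.of_dist_le' fun z z' => ?_) (fun ε hε => S.almostC1_density D hε) t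
  rw [dist_eq_norm, dist_eq_norm, mul_assoc]
  refine (D.density_lip _ _).trans ?_
  gcongr
  exact S.flow_lip _ _ _ _

theorem IsTruncatedSolution.continuous_fderiv_density (S : IsTruncatedSolution N P f₀ B₀ ψ Z B)
    (D : RegularData N P f₀ B₀ ψ) :
    Continuous fun p : ℝ × ℝ × ℝ => fderiv ℝ (fun z => f₀ (Z 0 p.1 z)) p.2 :=
  continuous_clm_apply.2 fun h => AlmostC1.continuous_fderiv_apply
    (F := fun (t : ℝ) z => f₀ (Z 0 t z)) (fun _ hε => S.almostC1_density D hε)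
    (S.differentiable_density D) (S.continuous_density D) h

/-- By the flow property f₀(Z(0, s, z)) = f₀(Z(0, t, Z(t, s, z))). Hence only the spatial derivative
at time t and the derivative of Z(t, s, z) in s at s = t are needed, and the latter is minus the
force. -/
theorem IsTruncatedSolution.hasDerivAt_density_time (S : IsTruncatedSolution N P f₀ B₀ ψ Z B)
    (D : RegularData N P f₀ B₀ ψ) {t : ℝ} (ht : t ∈ Ioo (-shortTime N) (shortTime N))
    (z : ℝ × ℝ) : HasDerivAt (fun s => f₀ (Z 0 s z))
      (-fderiv ℝ (fun z => f₀ (Z 0 t z)) z (force ψ B t z)) t := by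
  have hH : Continuous fun p : ℝ × ℝ => force ψ B p.1 (Z p.1 p.2 z) :=
    (S.continuous_force_flow D).comp (by fun_prop : Continuous fun p : ℝ × ℝ => (p.1, p.2, z))
  have h1 := (hasDerivAt_integral_left_diag (H := fun τ r => force ψ B τ (Z τ r z)) hH t).const_add z
  rw [S.flow_self] at h1
  have hclamp : ∀ s ∈ Ioo (-shortTime N) (shortTime N), clamp (shortTime N) s = s :=
    fun s hs => clamp_of_abs_le (abs_le.2 ⟨hs.1.le, hs.2.le⟩)
  have h2 : HasDerivAt (fun r => Z t r z) (-force ψ B t z) t := by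
    refine h1.congr_of_eventuallyEq ?_
    filter_upwards [isOpen_Ioo.mem_nhds ht] with r hr
    rw [S.flow_eq, hclamp r hr, hclamp t ht]
  have h3 : HasFDerivAt (fun z => f₀ (Z 0 t z)) (fderiv ℝ (fun z => f₀ (Z 0 t z)) z) (Z t t z) := by
    rw [S.flow_self]
    exact (S.differentiable_density D t z).hasFDerivAt
  have h4 := h3.comp_hasDerivAt t h2
  rw [map_neg] at h4
  refine h4.congr_of_eventuallyEq (Eventually.of_forall fun r => ?_)
  simp only [Function.comp, S.flow_flow D]

theorem IsTruncatedSolution.contDiffOn_density (S : IsTruncatedSolution N P f₀ B₀ ψ Z B)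
    (D : RegularData N P f₀ B₀ ψ) : ContDiffOn ℝ 1 (fun p : ℝ × ℝ × ℝ => f₀ (Z 0 p.1 p.2))
      (Ioo (-shortTime N) (shortTime N) ×ˢ univ) :=
  contDiffOn_of_partial isOpen_Ioo (F := fun t z => f₀ (Z 0 t z))
    (fun _ ht z => S.hasDerivAt_density_time D ht z)
    (fun t _ z => (S.differentiable_density D t z).hasFDerivAt)
    ((S.continuous_fderiv_density D).clm_apply (D.continuous_force S.continuous_field)).neg
    (S.continuous_fderiv_density D)

theorem IsTruncatedSolution.differentiable_field (S : IsTruncatedSolution N P f₀ B₀ ψ Z B)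
    (D : RegularData N P f₀ B₀ ψ) (t : ℝ) : Differentiable ℝ (B t) :=
  AlmostC1.differentiable (L := (N + 1).toNNReal) (fun t => LipschitzWith.of_dist_le' fun x y => by
    rw [dist_eq_norm, dist_eq_norm]; exact S.field_lip t x y)
    (fun _ hε => (S.almostC1 D hε).2) t

theorem IsTruncatedSolution.continuous_fderiv_field (S : IsTruncatedSolution N P f₀ B₀ ψ Z B)
    (D : RegularData N P f₀ B₀ ψ) : Continuous fun p : ℝ × ℝ => fderiv ℝ (B p.1) p.2 :=
  continuous_clm_apply.2 fun h => AlmostC1.continuous_fderiv_apply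
    (fun _ hε => (S.almostC1 D hε).2) (S.differentiable_field D) S.continuous_field h

theorem IsTruncatedSolution.continuous_charge (S : IsTruncatedSolution N P f₀ B₀ ψ Z B)
    (D : RegularData N P f₀ B₀ ψ) :
    Continuous fun p : ℝ × ℝ => ∫ w in -P..P, f₀ (Z 0 p.1 (p.2, w)) :=
  intervalIntegral.continuous_parametric_intervalIntegral_of_continuous'
    (f := fun (p : ℝ × ℝ) w => f₀ (Z 0 p.1 (p.2, w)))
    ((S.continuous_density D).comp
      (by fun_prop : Continuous fun q : (ℝ × ℝ) × ℝ => (q.1.1, (q.1.2, q.2)))) _ _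

/-- Along lines of speed one the field is a primitive of the charge density. -/
theorem IsTruncatedSolution.hasDerivAt_field_line (S : IsTruncatedSolution N P f₀ B₀ ψ Z B)
    (D : RegularData N P f₀ B₀ ψ) {t : ℝ} (ht : t ∈ Ioo (-shortTime N) (shortTime N)) (y : ℝ) :
    HasDerivAt (fun s => B s (y + s)) (∫ w in -P..P, f₀ (Z 0 t (y + t, w))) t := by
  have hc : Continuous fun σ : ℝ => ∫ w in -P..P, f₀ (Z 0 σ (y + σ, w)) :=
    (S.continuous_charge D).comp (by fun_prop : Continuous fun σ : ℝ => (σ, y + σ))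
  have h1 := (hc.integral_hasStrictDerivAt 0 t).hasDerivAt.const_add (B₀ y)
  refine h1.congr_of_eventuallyEq ?_
  filter_upwards [isOpen_Ioo.mem_nhds ht] with s hs
  rw [S.field_eq, clamp_of_abs_le (abs_le.2 ⟨hs.1.le, hs.2.le⟩), add_sub_cancel_right]

/-- In the coordinates (t, x - t) the time derivative of the field is the charge density, which is
continuous. The partial derivatives are thus continuous in these coordinates, and a linear change of
variables returns to (t, x). -/
theorem IsTruncatedSolution.contDiffOn_field (S : IsTruncatedSolution N P f₀ B₀ ψ Z B)
    (D : RegularData N P f₀ B₀ ψ) : ContDiffOn ℝ 1 (fun p : ℝ × ℝ => B p.1 p.2)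
      (Ioo (-shortTime N) (shortTime N) ×ˢ univ) := by
  have h1 : ContDiffOn ℝ 1 (fun p : ℝ × ℝ => B p.1 (p.2 + p.1))
      (Ioo (-shortTime N) (shortTime N) ×ˢ univ) := by
    refine contDiffOn_of_partial isOpen_Ioo (F := fun t y => B t (y + t))
      (A := fun t y => fderiv ℝ (B t) (y + t))
      (fun _ ht y => S.hasDerivAt_field_line D ht y) (fun t _ y => ?_) ?_ ?_
    · exact (S.differentiable_field D t (y + t)).hasFDerivAt.comp y
        ((hasFDerivAt_id y).add_const t)
    · exact (S.continuous_charge D).comp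
        (by fun_prop : Continuous fun p : ℝ × ℝ => (p.1, p.2 + p.1))
    · exact (S.continuous_fderiv_field D).comp
        (by fun_prop : Continuous fun p : ℝ × ℝ => (p.1, p.2 + p.1))
  have h2 : ContDiff ℝ 1 fun p : ℝ × ℝ => (p.1, p.2 - p.1) := by fun_prop
  have h3 := h1.comp h2.contDiffOn (s := Ioo (-shortTime N) (shortTime N) ×ˢ univ)
    fun p hp => ⟨hp.1, mem_univ _⟩
  refine h3.congr fun p _ => ?_
  simp only [Function.comp, sub_add_cancel]

theorem IsTruncatedSolution.hasDerivAt_field_time (S : IsTruncatedSolution N P f₀ B₀ ψ Z B)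
    (D : RegularData N P f₀ B₀ ψ) {t : ℝ} (ht : t ∈ Ioo (-shortTime N) (shortTime N)) (x : ℝ) :
    HasDerivAt (fun s => B s x) ((∫ w in -P..P, f₀ (Z 0 t (x, w))) - deriv (fun y => B t y) x)
      t := by
  have hmem : (t, x) ∈ Ioo (-shortTime N) (shortTime N) ×ˢ (univ : Set ℝ) := ⟨ht, mem_univ _⟩
  have hF := ((S.contDiffOn_field D).differentiableOn one_ne_zero _ hmem).differentiableAt
    ((isOpen_Ioo.prod isOpen_univ).mem_nhds hmem) |>.hasFDerivAt
  set F' := fderiv ℝ (fun p : ℝ × ℝ => B p.1 p.2) (t, x)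
  have ht' : HasDerivAt (fun s => B s x) (F' (1, 0)) t :=
    hF.comp_hasDerivAt (f := fun s => (s, x)) t ((hasDerivAt_id t).prodMk (hasDerivAt_const t x))
  have hx' : HasDerivAt (fun y => B t y) (F' (0, 1)) x :=
    hF.comp_hasDerivAt (f := fun y => (t, y)) x ((hasDerivAt_const x t).prodMk (hasDerivAt_id x))
  have hl := S.hasDerivAt_field_line D ht (x - t)
  have hl' : HasDerivAt (fun s => B s (x - t + s)) (F' (1, 1)) t := by
    have hF2 : HasFDerivAt (fun p : ℝ × ℝ => B p.1 p.2) F' (t, x - t + t) := by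
      rwa [sub_add_cancel]
    exact hF2.comp_hasDerivAt (f := fun s => (s, x - t + s)) t
      ((hasDerivAt_id t).prodMk ((hasDerivAt_id t).const_add (x - t)))
  rw [sub_add_cancel] at hl
  have e : F' (1, 1) = F' (1, 0) + F' (0, 1) := by rw [← map_add]; simp
  rw [hl.unique hl', hx'.deriv, e, add_sub_cancel_right]
  exact ht'

end Truncated

/-! ### Local existence: introducing and removing the cut-offs -/

theorem exists_abs_sub_le_of_hasCompactSupport {g : ℝ → ℝ} (hg : ContDiff ℝ 1 g)
    (hc : HasCompactSupport g) : ∃ C, ∀ x y, |g x - g y| ≤ C * |x - y| := by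
  obtain ⟨C, hC⟩ := hg.lipschitzWith_of_hasCompactSupport hc one_ne_zero
  exact ⟨C, fun x y => by simpa [dist_eq_norm] using hC.dist_le_mul x y⟩

theorem exists_cutoff {R : ℝ} (hR : 0 ≤ R) : ∃ χ : ℝ → ℝ, ContDiff ℝ 1 χ ∧
    (∀ x, |x| ≤ R + 2 → χ x = 1) ∧ (∀ x, R + 3 ≤ |x| → χ x = 0) ∧ ∀ x, |χ x| ≤ 1 := by
  let b : ContDiffBump (0 : ℝ) := ⟨R + 2, R + 3, by linarith, by linarith⟩
  refine ⟨b, b.contDiff, fun x hx => b.one_of_mem_closedBall ?_, fun x hx => b.zero_of_le_dist ?_,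
    fun x => ?_⟩
  · simpa using hx
  · simpa using hx
  · rw [abs_of_nonneg b.nonneg]; exact b.le_one

/-- The cut-off and N are chosen from R and A alone, before the data, so that the existence time is
uniform over all data with these bounds. -/
theorem RegularData.exists_of_bounds {R A : ℝ} (hR : 0 ≤ R) (hA : 0 ≤ A) :
    ∃ N : ℝ, 1 ≤ N ∧ ∃ χ : ℝ → ℝ, ContDiff ℝ 1 χ ∧ (∀ x, |x| ≤ R + 2 → χ x = 1) ∧
      ∀ (f₀ : ℝ × ℝ → ℝ) (B₀ : ℝ → ℝ), ContDiff ℝ 1 f₀ → ContDiff ℝ 1 B₀ →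
        (∀ x v, f₀ (x, v) ≠ 0 → |x| ≤ R ∧ |v| ≤ R) → (∀ z, |f₀ z| ≤ A) →
        (∀ z z', |f₀ z - f₀ z'| ≤ A * ‖z - z'‖) →
        (∀ x, |x| ≤ R + 3 → |B₀ x| ≤ A ∧ |deriv B₀ x| ≤ A) →
        RegularData N (R + 2) f₀ (fun x => χ x * B₀ x) (fun v => χ v * v) := by
  obtain ⟨χ, hχ, hχ1, hχ0, hχle⟩ := exists_cutoff hR
  have hsupp : ∀ g : ℝ → ℝ, HasCompactSupport fun x => χ x * g x := fun g =>
    HasCompactSupport.intro (K := Icc (-(R + 3)) (R + 3)) isCompact_Icc fun x hx => by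
      have : R + 3 ≤ |x| := by
        by_contra! h
        exact hx (abs_le.1 h.le)
      rw [hχ0 x this, zero_mul]
  have hψ : ContDiff ℝ 1 fun v => χ v * v := hχ.mul contDiff_id
  obtain ⟨C₁, hC₁⟩ := exists_abs_sub_le_of_hasCompactSupport hψ (hsupp _)
  obtain ⟨C₂, hC₂⟩ := exists_abs_sub_le_of_hasCompactSupport hχ (by simpa using hsupp fun _ => 1)
  have hC₂0 : 0 ≤ C₂ := by
    have := (abs_nonneg _).trans (hC₂ 1 0)
    simpa using this
  -- R + 3 bounds the truncated speed and exceeds the velocity range R + 2. C₁ is the Lipschitz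
  -- constant of the truncated speed, and C₂A + A bounds the derivative of χB₀ by the product rule.
  set N := max (max (R + 3) A) (max C₁ (C₂ * A + A)) with hN
  have hN1 : R + 3 ≤ N := (le_max_left _ _).trans (le_max_left _ _)
  have hN4 : A ≤ N := (le_max_right _ _).trans (le_max_left _ _)
  have hN2 : C₁ ≤ N := (le_max_left _ _).trans (le_max_right _ _)
  have hN3 : C₂ * A + A ≤ N := (le_max_right _ _).trans (le_max_right _ _)
  refine ⟨N, by linarith, χ, hχ, hχ1, fun f₀ B₀ hf₀ hB₀ hs hb hl hB => ?_⟩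
  have hχB : ContDiff ℝ 1 fun x => χ x * B₀ x := hχ.mul hB₀
  have hf₀c : HasCompactSupport f₀ :=
    HasCompactSupport.intro (K := Icc (-R) R ×ˢ Icc (-R) R) (isCompact_Icc.prod isCompact_Icc)
      fun z hz => by
        by_contra h
        have := hs z.1 z.2 h
        exact hz ⟨abs_le.1 this.1, abs_le.1 this.2⟩
  have hcut : ∀ (g : ℝ → ℝ) (C : ℝ), 0 ≤ C → (∀ x, |x| ≤ R + 3 → |g x| ≤ C) →
      ∀ x, |χ x * g x| ≤ C := by
    intro g C hC hg x
    rcases le_total |x| (R + 3) with h | h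
    · rw [abs_mul]
      calc _ ≤ 1 * C := by gcongr; exacts [hχle x, hg x h]
        _ = C := one_mul C
    · rw [hχ0 x h, zero_mul, abs_zero]; exact hC
  have hχd : ∀ x, |deriv χ x| ≤ C₂ := by
    intro x
    have := norm_deriv_le_of_lip' (f := χ) (x₀ := x) hC₂0 (Eventually.of_forall fun y => hC₂ y x)
    exact this
  have hderiv : ∀ x, ‖deriv (fun x => χ x * B₀ x) x‖ ≤ N := by
    intro x
    rcases le_or_gt |x| (R + 3) with h | h
    · have hd := ((hχ.differentiable one_ne_zero x).hasDerivAt).mul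
        ((hB₀.differentiable one_ne_zero x).hasDerivAt)
      have e : deriv (fun x => χ x * B₀ x) x = deriv χ x * B₀ x + χ x * deriv B₀ x := hd.deriv
      rw [e]
      refine (norm_add_le _ _).trans (le_trans ?_ hN3)
      rw [norm_mul, norm_mul]
      refine add_le_add ?_ ?_
      · gcongr; exacts [hχd x, (hB x h).1]
      · calc _ ≤ 1 * A := by gcongr; exacts [hχle x, (hB x h).2]
          _ = A := one_mul A
    · have e : (fun x => χ x * B₀ x) =ᶠ[𝓝 x] fun _ => 0 := by
        filter_upwards [(isOpen_lt continuous_const continuous_abs).mem_nhds h] with y hy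
        rw [hχ0 y (le_of_lt hy), zero_mul]
      rw [e.deriv_eq, deriv_const, norm_zero]
      linarith
  refine ⟨by linarith, by linarith, by linarith, fun z => (hb z).trans (by linarith),
    fun z z' => (hl z z').trans (by gcongr),
    fun ε hε => almostC1_of_hasCompactSupport hf₀ hf₀c hε,
    hcut B₀ N (by linarith) fun x hx => (hB x hx).1.trans (by linarith), ?_,
    fun ε hε => almostC1_of_hasCompactSupport hχB (hsupp _) hε,
    hcut id N (by linarith) fun x hx => hx.trans hN1,
    fun v w => (hC₁ v w).trans (by gcongr),
    fun ε hε => almostC1_of_hasCompactSupport hψ (hsupp _) hε⟩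
  intro x y
  exact convex_univ.norm_image_sub_le_of_norm_deriv_le (f := fun x => χ x * B₀ x)
    (fun z _ => hχB.differentiable one_ne_zero z) (fun z _ => hderiv z) (mem_univ y) (mem_univ x)

/-- Local existence on a time interval whose length depends only on bounds for the data; for the
field only bounds near the support of the density matter. -/
theorem exists_solution_of_bounds {R A : ℝ} (hR : 0 ≤ R) (hA : 0 ≤ A) :
    ∃ δ > 0, ∀ (f₀ : ℝ × ℝ → ℝ) (B₀ : ℝ → ℝ),
    ContDiff ℝ 1 f₀ → ContDiff ℝ 1 B₀ →
    (∀ x v, f₀ (x, v) ≠ 0 → |x| ≤ R ∧ |v| ≤ R) → (∀ z, |f₀ z| ≤ A) →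
    (∀ z z', |f₀ z - f₀ z'| ≤ A * ‖z - z'‖) →
    (∀ x, |x| ≤ R + 3 → |B₀ x| ≤ A ∧ |deriv B₀ x| ≤ A) →
    ∃ f B, IsClassicalSolution f₀ B₀ δ f B := by
  obtain ⟨N, hN, χ, hχ, hχ1, H⟩ := RegularData.exists_of_bounds hR hA
  have hT := shortTime_pos hN
  have hT1 : shortTime N ≤ 1 := by nlinarith [shortTime_mul_le hN]
  refine ⟨shortTime N / 2, by positivity, fun f₀ B₀ hf₀ hB₀ hs hb hl hB => ?_⟩
  have D := H f₀ B₀ hf₀ hB₀ hs hb hl hB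
  obtain ⟨Z, B, S⟩ := D.exists_truncatedSolution
  -- The truncated solution lives on a symmetric open interval. Half of its length keeps both 0 and
  -- the final time in the interior, so one-sided derivatives come from two-sided ones.
  have hsub : Icc 0 (shortTime N / 2) ⊆ Ioo (-shortTime N) (shortTime N) :=
    fun t ht => ⟨by linarith [ht.1], by linarith [ht.2]⟩
  have hsupp : ∀ t x v, f₀ (Z 0 t (x, v)) ≠ 0 → |x| ≤ R + 1 ∧ |v| ≤ R + 1 := by
    intro t x v hne
    have h1 := hs _ _ hne
    have h2 := norm_prod_le_iff.1 (S.norm_flow_sub_le D 0 t (x, v))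
    simp only [Prod.fst_sub, Prod.snd_sub, Real.norm_eq_abs] at h2
    rw [abs_sub_comm, abs_sub_comm _ v] at h2
    constructor
    · linarith [abs_sub_abs_le_abs_sub x (Z 0 t (x, v)).1]
    · linarith [abs_sub_abs_le_abs_sub v (Z 0 t (x, v)).2]
  -- The part of B₀ removed by the cut-off. Its translate g(x - t) solves the free field equation,
  -- and for t ≤ 1 it vanishes where |x| ≤ R + 1, that is, where the density lives.
  set g : ℝ → ℝ := fun x => B₀ x - χ x * B₀ x with hg
  have hgC : ContDiff ℝ 1 g := hB₀.sub (hχ.mul hB₀)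
  have hg0 : ∀ x, |x| ≤ R + 2 → g x = 0 := fun x hx => by simp [hg, hχ1 x hx]
  have hgd : ∀ t x, HasDerivAt (fun y => g (y - t)) (deriv g (x - t)) x := fun t x => by
    have := ((hgC.differentiable one_ne_zero (x - t)).hasDerivAt).comp x
      ((hasDerivAt_id x).sub_const t)
    exact this.congr_deriv (by simp)
  have hgt : ∀ t x, HasDerivAt (fun s => g (x - s)) (-deriv g (x - t)) t := fun t x => by
    have := ((hgC.differentiable one_ne_zero (x - t)).hasDerivAt).comp t
      ((hasDerivAt_id t).const_sub x)
    exact this.congr_deriv (by simp)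
  have hfd : ∀ t x v, HasFDerivAt (fun z => f₀ (Z 0 t z))
      (fderiv ℝ (fun z => f₀ (Z 0 t z)) (x, v)) (x, v) :=
    fun t x v => (S.differentiable_density D t (x, v)).hasFDerivAt
  have hfx : ∀ t x v, HasDerivAt (fun y => f₀ (Z 0 t (y, v)))
      (fderiv ℝ (fun z => f₀ (Z 0 t z)) (x, v) (1, 0)) x := fun t x v =>
    (hfd t x v).comp_hasDerivAt (f := fun y => (y, v)) x
      ((hasDerivAt_id x).prodMk (hasDerivAt_const x v))
  have hfv : ∀ t x v, HasDerivAt (fun w => f₀ (Z 0 t (x, w)))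
      (fderiv ℝ (fun z => f₀ (Z 0 t z)) (x, v) (0, 1)) v := fun t x v =>
    (hfd t x v).comp_hasDerivAt (f := fun w => (x, w)) v
      ((hasDerivAt_const v x).prodMk (hasDerivAt_id v))
  refine ⟨fun t x v => f₀ (Z 0 t (x, v)), fun t x => B t x + g (x - t), by positivity,
    ⟨(S.contDiffOn_density D).mono (prod_mono_left hsub), Icc (-(R + 1)) (R + 1) ×ˢ
      Icc (-(R + 1)) (R + 1), isCompact_Icc.prod isCompact_Icc, fun t _ x v hxv => ?_⟩, ?_,
    fun t ht x v => ?_, fun t ht x => ?_, fun x v => ?_, fun x => ?_⟩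
  · by_contra hne
    have := hsupp t x v hne
    exact hxv ⟨abs_le.1 this.1, abs_le.1 this.2⟩
  · refine ContDiffOn.add ((S.contDiffOn_field D).mono (prod_mono_left hsub)) ?_
    exact (hgC.comp (by fun_prop : ContDiff ℝ 1 fun p : ℝ × ℝ => p.2 - p.1)).contDiffOn
  · have htime := (S.hasDerivAt_density_time D (hsub ht) (x, v)).hasDerivWithinAt
      (s := Icc 0 (shortTime N / 2))
    rw [htime.derivWithin (uniqueDiffOn_Icc (by positivity) t ht), (hfx t x v).deriv,
      (hfv t x v).deriv]
    set A := fderiv ℝ (fun z => f₀ (Z 0 t z)) (x, v)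
    have e : force (fun v => χ v * v) B t (x, v) = ((χ v * v) : ℝ) • ((1 : ℝ), (0 : ℝ)) + (B t x) • ((0 : ℝ), (1 : ℝ)) := by
      simp [force]
    -- The truncated speed differs from v only for |v| > R + 2, where the density vanishes for every
    -- position.
    have e1 : (χ v * v - v) * A (1, 0) = 0 := by
      by_cases hv : |v| ≤ R + 2
      · rw [hχ1 v hv]; ring
      · have hz : (fun y => f₀ (Z 0 t (y, v))) = fun _ => 0 := by
          funext y
          by_contra hne
          exact hv (by linarith [(hsupp t y v hne).2])
        have := hfx t x v
        rw [hz] at this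
        rw [this.unique (hasDerivAt_const x 0), mul_zero]
    have e2 : g (x - t) * A (0, 1) = 0 := by
      by_cases hx : |x| ≤ R + 1
      · rw [hg0, zero_mul]
        have h1 := abs_sub x t
        have h2 : |t| ≤ 1 := by rw [abs_of_nonneg ht.1]; linarith [ht.2]
        linarith
      · have hz : (fun w => f₀ (Z 0 t (x, w))) = fun _ => 0 := by
          funext w
          by_contra hne
          exact hx (hsupp t x w hne).1
        have := hfv t x v
        rw [hz] at this
        rw [this.unique (hasDerivAt_const v 0), mul_zero]
    rw [e, map_add, map_smul, map_smul, smul_eq_mul, smul_eq_mul]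
    linear_combination -e1 + e2
  · have htime := ((S.hasDerivAt_field_time D (hsub ht) x).add (hgt t x)).hasDerivWithinAt
      (s := Icc 0 (shortTime N / 2))
    have hx := (S.differentiable_field D t x).hasDerivAt.add (hgd t x)
    have e1 : derivWithin (fun s => B s x + g (x - s)) (Icc 0 (shortTime N / 2)) t = _ :=
      htime.derivWithin (uniqueDiffOn_Icc (by positivity) t ht)
    have e2 : deriv (fun y => B t y + g (y - t)) x = _ := hx.deriv
    -- Velocities in the support are at most R + 1, so the truncated integral is the full one.
    have e3 : (∫ v, f₀ (Z 0 t (x, v))) = ∫ w in -(R + 2)..R + 2, f₀ (Z 0 t (x, w)) := by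
      rw [intervalIntegral.integral_of_le (by linarith)]
      refine (MeasureTheory.setIntegral_eq_integral_of_forall_compl_eq_zero fun v hv => ?_).symm
      by_contra hne
      have := abs_le.1 (hsupp t x v hne).2
      exact hv ⟨by linarith, by linarith⟩
    rw [e1, e2, e3]
    ring
  · simp only [S.flow_self]
  · simp only [sub_zero, S.field_eq, clamp_of_abs_le (abs_zero.trans_le hT.le),
      intervalIntegral.integral_same, add_zero, hg]
    ring

/-! ### Restriction, time shift, gluing and the maximal solution -/

section Gluing

variable {T : ℝ} {f₀ : ℝ × ℝ → ℝ} {B₀ : ℝ → ℝ} {f : ℝ → ℝ → ℝ → ℝ} {B : ℝ → ℝ → ℝ}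

theorem IsClassicalSolution.of_hasDerivWithinAt (hT : 0 < T) (hf : IsDensityClass T f)
    (hB : IsFieldClass T B)
    (hft : ∀ t ∈ Icc 0 T, ∀ x v, HasDerivWithinAt (fun s => f s x v)
      (-(v * deriv (fun y => f t y v) x) - B t x * deriv (fun w => f t x w) v) (Icc 0 T) t)
    (hBt : ∀ t ∈ Icc 0 T, ∀ x, HasDerivWithinAt (fun s => B s x)
      ((∫ v, f t x v) - deriv (fun y => B t y) x) (Icc 0 T) t)
    (hf₀ : ∀ x v, f 0 x v = f₀ (x, v)) (hB₀ : ∀ x, B 0 x = B₀ x) :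
    IsClassicalSolution f₀ B₀ T f B where
  pos := hT
  density := hf
  field := hB
  vlasov t ht x v := by
    rw [(hft t ht x v).derivWithin (uniqueDiffOn_Icc hT t ht)]; ring
  transport t ht x := by
    rw [(hBt t ht x).derivWithin (uniqueDiffOn_Icc hT t ht)]; ring
  init_density := hf₀
  init_field := hB₀

theorem IsClassicalSolution.hasDerivWithinAt_field_time (h : IsClassicalSolution f₀ B₀ T f B)
    {t : ℝ} (ht : t ∈ Icc 0 T) (x : ℝ) : HasDerivWithinAt (fun s => B s x)
      ((∫ v, f t x v) - deriv (fun y => B t y) x) (Icc 0 T) t := by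
  rw [← h.transport t ht x, add_sub_cancel_right]
  exact (h.field.hasDerivWithinAt_time ht x).differentiableWithinAt.hasDerivWithinAt

theorem IsClassicalSolution.restrict (h : IsClassicalSolution f₀ B₀ T f B) {S : ℝ} (hS : 0 < S)
    (hST : S ≤ T) : IsClassicalSolution f₀ B₀ S f B := by
  have hsub : Icc 0 S ⊆ Icc 0 T := Icc_subset_Icc_right hST
  obtain ⟨K, hK, hfK⟩ := h.density.2
  exact .of_hasDerivWithinAt hS
    ⟨h.density.1.mono (prod_mono_left hsub), K, hK, fun t ht => hfK t (hsub ht)⟩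
    (ContDiffOn.mono h.field (prod_mono_left hsub))
    (fun t ht x v => (h.hasDerivWithinAt_density (hsub ht) x v).mono hsub)
    (fun t ht x => (h.hasDerivWithinAt_field_time (hsub ht) x).mono hsub)
    h.init_density h.init_field

theorem IsClassicalSolution.congr (h : IsClassicalSolution f₀ B₀ T f B)
    {g : ℝ → ℝ → ℝ → ℝ} {D : ℝ → ℝ → ℝ} (hg : ∀ t ∈ Icc 0 T, g t = f t)
    (hD : ∀ t ∈ Icc 0 T, D t = B t) : IsClassicalSolution f₀ B₀ T g D := by
  have h0 : (0 : ℝ) ∈ Icc 0 T := left_mem_Icc.2 h.pos.le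
  obtain ⟨K, hK, hfK⟩ := h.density.2
  refine .of_hasDerivWithinAt h.pos
    ⟨h.density.1.congr fun p hp => by simp only [hg p.1 hp.1], K, hK, fun t ht => by
      rw [hg t ht]; exact hfK t ht⟩
    (ContDiffOn.congr h.field fun p hp => by simp only [hD p.1 hp.1])
    (fun t ht x v => ?_) (fun t ht x => ?_) ?_ ?_
  · rw [hg t ht, hD t ht]
    exact (h.hasDerivWithinAt_density ht x v).congr (fun s hs => by rw [hg s hs]) (by rw [hg t ht])
  · rw [hg t ht, hD t ht]
    exact (h.hasDerivWithinAt_field_time ht x).congr (fun s hs => by rw [hD s hs]) (by rw [hD t ht])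
  · rw [hg 0 h0]; exact h.init_density
  · rw [hD 0 h0]; exact h.init_field

theorem IsClassicalSolution.shift (h : IsClassicalSolution f₀ B₀ T f B) {t₀ : ℝ} (ht₀ : 0 ≤ t₀)
    (ht₀T : t₀ < T) : IsClassicalSolution (fun z => f t₀ z.1 z.2) (B t₀) (T - t₀)
      (fun t => f (t₀ + t)) (fun t => B (t₀ + t)) := by
  have hsub : ∀ t ∈ Icc 0 (T - t₀), t₀ + t ∈ Icc 0 T := fun t ht =>
    ⟨by linarith [ht.1], by linarith [ht.2]⟩
  have hid : ∀ t, HasDerivWithinAt (fun s => t₀ + s) 1 (Icc 0 (T - t₀)) t := fun t =>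
    (hasDerivWithinAt_id t _).const_add t₀
  obtain ⟨K, hK, hfK⟩ := h.density.2
  refine .of_hasDerivWithinAt (by linarith)
    ⟨?_, K, hK, fun t ht => hfK _ (hsub t ht)⟩ ?_ (fun t ht x v => ?_) (fun t ht x => ?_)
    (fun x v => by rw [add_zero]) (fun x => by rw [add_zero])
  · exact h.density.1.comp
      (by fun_prop : ContDiff ℝ 1 fun p : ℝ × ℝ × ℝ => (t₀ + p.1, p.2)).contDiffOn
      fun p hp => ⟨hsub _ hp.1, mem_univ _⟩
  · exact ContDiffOn.comp h.field
      (by fun_prop : ContDiff ℝ 1 fun p : ℝ × ℝ => (t₀ + p.1, p.2)).contDiffOn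
      fun p hp => ⟨hsub _ hp.1, mem_univ _⟩
  · have := (h.hasDerivWithinAt_density (hsub t ht) x v).comp t (hid t) hsub
    rwa [mul_one] at this
  · have := (h.hasDerivWithinAt_field_time (hsub t ht) x).comp t (hid t) hsub
    rwa [mul_one] at this

theorem Icc_left_mem_nhdsWithin {T₁ T₂ t : ℝ} (ht : t < T₁) : Icc 0 T₁ ∈ 𝓝[Icc 0 T₂] t := by
  filter_upwards [self_mem_nhdsWithin, mem_nhdsWithin_of_mem_nhds (Iio_mem_nhds ht)] with s hs hs'
  exact ⟨hs.1, le_of_lt hs'⟩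

theorem Icc_right_mem_nhdsWithin {t₀ T₂ t : ℝ} (ht : t₀ < t) : Icc t₀ T₂ ∈ 𝓝[Icc 0 T₂] t := by
  filter_upwards [self_mem_nhdsWithin, mem_nhdsWithin_of_mem_nhds (Ioi_mem_nhds ht)] with s hs hs'
  exact ⟨le_of_lt hs', hs.2⟩

theorem prod_univ_mem_nhdsWithin {E : Type*} [TopologicalSpace E] {s u : Set ℝ} {p : ℝ × E}
    (h : s ∈ 𝓝[u] p.1) : s ×ˢ (univ : Set E) ∈ 𝓝[u ×ˢ univ] p := by
  obtain ⟨x, y⟩ := p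
  rw [nhdsWithin_prod_eq]
  exact prod_mem_prod h (by simp)

/-- Two solutions on overlapping time intervals make up one solution. -/
theorem IsClassicalSolution.glue {f₁ : ℝ × ℝ → ℝ} {B₁ : ℝ → ℝ} {t₀ T₁ T₂ : ℝ} (ht₀T : t₀ < T₁)
    (h : IsClassicalSolution f₀ B₀ T₁ f B)
    (h' : IsClassicalSolution f₁ B₁ (T₂ - t₀) (fun t => f (t₀ + t)) (fun t => B (t₀ + t)))
    (hT : T₁ ≤ T₂) : IsClassicalSolution f₀ B₀ T₂ f B := by
  have hsub : ∀ t ∈ Icc t₀ T₂, t - t₀ ∈ Icc 0 (T₂ - t₀) := fun t ht =>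
    ⟨by linarith [ht.1], by linarith [ht.2]⟩
  have hid : ∀ t, HasDerivWithinAt (fun s => s - t₀) 1 (Icc t₀ T₂) t := fun t =>
    (hasDerivWithinAt_id t _).sub_const t₀
  obtain ⟨K, hK, hfK⟩ := h.density.2
  obtain ⟨K', hK', hfK'⟩ := h'.density.2
  refine .of_hasDerivWithinAt (h.pos.trans_le hT)
    ⟨fun p hp => ?_, K ∪ K', hK.union hK', fun t ht x v hxv => ?_⟩ (fun p hp => ?_)
    (fun t ht x v => ?_) (fun t ht x => ?_) h.init_density h.init_field
  · rcases lt_or_ge p.1 T₁ with hlt | hge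
    · exact (h.density.1 p ⟨⟨hp.1.1, hlt.le⟩, mem_univ _⟩).mono_of_mem_nhdsWithin
        (prod_univ_mem_nhdsWithin (Icc_left_mem_nhdsWithin hlt))
    · have hp' : t₀ < p.1 := ht₀T.trans_le hge
      have h2 := (h'.density.1.comp
        (by fun_prop : ContDiff ℝ 1 fun p : ℝ × ℝ × ℝ => (p.1 - t₀, p.2)).contDiffOn
        (s := Icc t₀ T₂ ×ˢ univ) fun p hp => ⟨hsub _ hp.1, mem_univ _⟩) p
        ⟨⟨hp'.le, hp.1.2⟩, mem_univ _⟩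
      simp only [Function.comp_def, add_sub_cancel] at h2
      exact h2.mono_of_mem_nhdsWithin
        (prod_univ_mem_nhdsWithin (Icc_right_mem_nhdsWithin hp'))
  · rw [mem_union, not_or] at hxv
    rcases lt_or_ge t T₁ with hlt | hge
    · exact hfK t ⟨ht.1, hlt.le⟩ x v hxv.1
    · have := hfK' (t - t₀) (hsub t ⟨ht₀T.le.trans hge, ht.2⟩) x v hxv.2
      simpa using this
  · rcases lt_or_ge p.1 T₁ with hlt | hge
    · exact ((h.field : ContDiffOn ℝ 1 _ _) p
        ⟨⟨hp.1.1, hlt.le⟩, mem_univ _⟩).mono_of_mem_nhdsWithin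
        (prod_univ_mem_nhdsWithin (Icc_left_mem_nhdsWithin hlt))
    · have hp' : t₀ < p.1 := ht₀T.trans_le hge
      have h2 := (ContDiffOn.comp h'.field
        (by fun_prop : ContDiff ℝ 1 fun p : ℝ × ℝ => (p.1 - t₀, p.2)).contDiffOn
        (s := Icc t₀ T₂ ×ˢ univ) fun p hp => ⟨hsub _ hp.1, mem_univ _⟩) p
        ⟨⟨hp'.le, hp.1.2⟩, mem_univ _⟩
      simp only [Function.comp_def, add_sub_cancel] at h2
      exact h2.mono_of_mem_nhdsWithin
        (prod_univ_mem_nhdsWithin (Icc_right_mem_nhdsWithin hp'))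
  · rcases lt_or_ge t T₁ with hlt | hge
    · exact (h.hasDerivWithinAt_density ⟨ht.1, hlt.le⟩ x v).mono_of_mem_nhdsWithin
        (Icc_left_mem_nhdsWithin hlt)
    · have ht' : t₀ < t := ht₀T.trans_le hge
      have h2 := (h'.hasDerivWithinAt_density (hsub t ⟨ht'.le, ht.2⟩) x v).comp t (hid t) hsub
      simp only [Function.comp_def, add_sub_cancel, mul_one] at h2
      exact h2.mono_of_mem_nhdsWithin (Icc_right_mem_nhdsWithin ht')
  · rcases lt_or_ge t T₁ with hlt | hge
    · exact (h.hasDerivWithinAt_field_time ⟨ht.1, hlt.le⟩ x).mono_of_mem_nhdsWithin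
        (Icc_left_mem_nhdsWithin hlt)
    · have ht' : t₀ < t := ht₀T.trans_le hge
      have h2 := (h'.hasDerivWithinAt_field_time (hsub t ⟨ht'.le, ht.2⟩) x).comp t (hid t) hsub
      simp only [Function.comp_def, add_sub_cancel, mul_one] at h2
      exact h2.mono_of_mem_nhdsWithin (Icc_right_mem_nhdsWithin ht')

/-- The second solution starts strictly before T, and uniqueness identifies the two on the overlap
[t₀, T]. Near every time the glued pair is then one of the two solutions, so no matching of
derivatives at a junction is needed. -/
theorem IsClassicalSolution.extend {g : ℝ → ℝ → ℝ → ℝ} {D : ℝ → ℝ → ℝ} {t₀ δ : ℝ}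
    (h : IsClassicalSolution f₀ B₀ T f B) (ht₀ : 0 ≤ t₀) (ht₀T : t₀ < T)
    (h' : IsClassicalSolution (fun z => f t₀ z.1 z.2) (B t₀) δ g D) (hT : T ≤ t₀ + δ) :
    ∃ F C, IsClassicalSolution f₀ B₀ (t₀ + δ) F C := by
  classical
  have hover := (h.shift ht₀ ht₀T).eq_of_eq_data (h'.restrict (by linarith) (by linarith))
  refine ⟨fun t => if t ≤ T then f t else g (t - t₀), fun t => if t ≤ T then B t else D (t - t₀),
    IsClassicalSolution.glue ht₀T (h.congr (fun t ht => if_pos ht.2) fun t ht => if_pos ht.2)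
      (f₁ := fun z => f t₀ z.1 z.2) (B₁ := B t₀) ?_ hT⟩
  rw [add_sub_cancel_left]
  refine h'.congr (fun t ht => ?_) fun t ht => ?_
  · split_ifs with hle
    · funext x v
      exact (hover t ⟨ht.1, by linarith⟩ x).1 v
    · rw [add_sub_cancel_left]
  · split_ifs with hle
    · funext x
      exact (hover t ⟨ht.1, by linarith⟩ x).2
    · rw [add_sub_cancel_left]

theorem IsClassicalSolution.le_lifespan (h : IsClassicalSolution f₀ B₀ T f B) :
    ENNReal.ofReal T ≤ lifespan f₀ B₀ :=
  le_iSup₂_of_le T ⟨f, B, h⟩ le_rfl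

theorem exists_solution_of_lt_lifespan (hT : ENNReal.ofReal T < lifespan f₀ B₀) :
    ∃ S > T, ∃ f B, IsClassicalSolution f₀ B₀ S f B := by
  simp only [lifespan, lt_iSup_iff] at hT
  obtain ⟨S, ⟨f, B, h⟩, hS⟩ := hT
  exact ⟨S, ((ENNReal.ofReal_lt_ofReal_iff h.pos).1 hS), f, B, h⟩

/-- By uniqueness, all solutions living beyond time t have the same value at t. That value is chosen
for each t, so the choice agrees with every solution on its interval except possibly at the final
time. -/
theorem exists_isMaximalSolution (f₀ : ℝ × ℝ → ℝ) (B₀ : ℝ → ℝ) :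
    ∃ f B, IsMaximalSolution f₀ B₀ f B := by
  classical
  have key : ∀ t : ℝ, ∃ q : (ℝ → ℝ → ℝ) × (ℝ → ℝ), ∀ S F C, 0 ≤ t → t < S →
      IsClassicalSolution f₀ B₀ S F C → q.1 = F t ∧ q.2 = C t := by
    intro t
    by_cases h : ∃ S F C, t < S ∧ IsClassicalSolution f₀ B₀ S F C
    · obtain ⟨S, F, C, htS, hs⟩ := h
      refine ⟨(F t, C t), fun S' F' C' ht htS' hs' => ?_⟩
      have hmin : 0 < min S S' := lt_min hs.pos hs'.pos
      have := (hs.restrict hmin (min_le_left _ _)).eq_of_eq_data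
        (hs'.restrict hmin (min_le_right _ _)) t ⟨ht, le_min htS.le htS'.le⟩
      exact ⟨funext fun x => funext fun v => (this x).1 v, funext fun x => (this x).2⟩
    · exact ⟨0, fun S F C _ htS hs => (h ⟨S, F, C, htS, hs⟩).elim⟩
  choose q hq using key
  refine ⟨fun t => (q t).1, fun t => (q t).2, fun T hT hlt => ?_⟩
  obtain ⟨S, hS, F, C, hs⟩ := exists_solution_of_lt_lifespan hlt
  exact (hs.restrict hT hS.le).congr
    (fun t ht => (hq t S F C ht.1 (ht.2.trans_lt hS) hs).1)
    (fun t ht => (hq t S F C ht.1 (ht.2.trans_lt hS) hs).2)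

end Gluing

/-! ### Continuation under a gradient bound, and blow-up -/

section Continuation

variable {T : ℝ} {f₀ : ℝ × ℝ → ℝ} {B₀ : ℝ → ℝ} {f : ℝ → ℝ → ℝ → ℝ} {B : ℝ → ℝ → ℝ}

theorem IsDensityClass.contDiff_slice (hf : IsDensityClass T f) {t : ℝ} (ht : t ∈ Icc 0 T) :
    ContDiff ℝ 1 fun z : ℝ × ℝ => f t z.1 z.2 := by
  rw [← contDiffOn_univ]
  exact hf.1.comp (by fun_prop : ContDiff ℝ 1 fun z : ℝ × ℝ => (t, z)).contDiffOn
    fun z _ => ⟨ht, mem_univ _⟩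

theorem IsFieldClass.contDiff_slice (hB : IsFieldClass T B) {t : ℝ} (ht : t ∈ Icc 0 T) :
    ContDiff ℝ 1 (B t) := by
  rw [← contDiffOn_univ]
  exact ContDiffOn.comp (g := fun p : ℝ × ℝ => B p.1 p.2) hB (by fun_prop : ContDiff ℝ 1 fun x : ℝ => (t, x)).contDiffOn
    fun z _ => ⟨ht, mem_univ _⟩

theorem IsDensityClass.abs_increment_le (hf : IsDensityClass T f) {t c : ℝ} (ht : t ∈ Icc 0 T)
    (hc : ∀ x v, |deriv (fun y => f t y v) x| ≤ c ∧ |deriv (fun w => f t x w) v| ≤ c)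
    (x v x' v' : ℝ) : |f t x v - f t x' v'| ≤ c * |x - x'| + c * |v - v'| := by
  have h1 := convex_univ.norm_image_sub_le_of_norm_deriv_le (f := fun y => f t y v) (C := c)
    (fun y _ => (hf.hasDerivAt_position ht y v).differentiableAt) (fun y _ => (hc y v).1)
    (mem_univ x') (mem_univ x)
  have h2 := convex_univ.norm_image_sub_le_of_norm_deriv_le (f := fun w => f t x' w) (C := c)
    (fun w _ => (hf.hasDerivAt_velocity ht x' w).differentiableAt) (fun w _ => (hc x' w).2)
    (mem_univ v') (mem_univ v)
  exact (abs_sub_le _ (f t x' v) _).trans (add_le_add h1 h2)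

theorem exists_abs_sub_le_of_contDiff {g : ℝ → ℝ} (hg : ContDiff ℝ 1 g) (r : ℝ) :
    ∃ K ≥ 0, ∀ x y, |x| ≤ r → |y| ≤ r → |g x - g y| ≤ K * |x - y| := by
  obtain ⟨K, hK⟩ := (isCompact_Icc (a := -r) (b := r)).exists_bound_of_continuousOn
    (hg.continuous_deriv le_rfl).continuousOn
  refine ⟨max K 0, le_max_right _ _, fun x y hx hy => ?_⟩
  exact (convex_Icc (-r) r).norm_image_sub_le_of_norm_deriv_le
    (fun z _ => hg.differentiable one_ne_zero z) (fun z hz => (hK z hz).trans (le_max_left _ _))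
    (abs_le.1 hy) (abs_le.1 hx)

theorem exists_classicalSolution (hf₀ : ContDiff ℝ 1 f₀) (hf₀c : HasCompactSupport f₀)
    (hB₀ : ContDiff ℝ 1 B₀) : ∃ T f B, IsClassicalSolution f₀ B₀ T f B := by
  obtain ⟨R, hR⟩ := hf₀c.isCompact.isBounded.exists_norm_le
  obtain ⟨M, hM⟩ := hf₀c.exists_bound_of_continuous hf₀.continuous
  obtain ⟨L, hL⟩ := hf₀.lipschitzWith_of_hasCompactSupport hf₀c one_ne_zero
  obtain ⟨C₁, hC₁⟩ := (isCompact_Icc (a := -(max R 0 + 3)) (b := max R 0 + 3)).exists_bound_of_continuousOn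
    hB₀.continuous.continuousOn
  obtain ⟨C₂, hC₂⟩ := (isCompact_Icc (a := -(max R 0 + 3)) (b := max R 0 + 3)).exists_bound_of_continuousOn
    (hB₀.continuous_deriv le_rfl).continuousOn
  set A := max (max M L) (max C₁ C₂) with hA
  have hAM : M ≤ A := (le_max_left _ _).trans (le_max_left _ _)
  have hAL : (L : ℝ) ≤ A := (le_max_right _ _).trans (le_max_left _ _)
  have hA1 : C₁ ≤ A := (le_max_left _ _).trans (le_max_right _ _)
  have hA2 : C₂ ≤ A := (le_max_right _ _).trans (le_max_right _ _)
  obtain ⟨δ, hδ, H⟩ := exists_solution_of_bounds (le_max_right R 0) (L.2.trans hAL)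
  refine ⟨δ, H f₀ B₀ hf₀ hB₀ (fun x v hne => ?_) (fun z => (hM z).trans hAM) (fun z z' => ?_)
    fun x hx => ⟨(hC₁ x (abs_le.1 hx)).trans hA1, (hC₂ x (abs_le.1 hx)).trans hA2⟩⟩
  · have := norm_prod_le_iff.1 (hR _ (subset_tsupport _ hne))
    exact ⟨this.1.trans (le_max_left _ _), this.2.trans (le_max_left _ _)⟩
  · have := hL.dist_le_mul z z'
    rw [dist_eq_norm, dist_eq_norm] at this
    exact this.trans (by gcongr)

/-- The spatial increments of the field grow at most linearly in time if the density is Lipschitz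
in position. -/
theorem IsClassicalSolution.abs_field_increment_le (h : IsClassicalSolution f₀ B₀ T f B)
    {c V : ℝ} (hV : 0 ≤ V) (hsupp : ∀ t ∈ Icc 0 T, ∀ x v, f t x v ≠ 0 → |v| ≤ V)
    (hlip : ∀ t ∈ Icc 0 T, ∀ x y v, |f t x v - f t y v| ≤ c * |x - y|) {t : ℝ} (ht : t ∈ Icc 0 T)
    (x y : ℝ) : |B t x - B t y| ≤ |B₀ (x - t) - B₀ (y - t)| + 2 * V * (c * |x - y|) * t := by
  have hu : ∀ s ∈ Icc 0 T, HasDerivWithinAt (fun s => B s (x - t + s) - B s (y - t + s))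
      ((∫ v, f s (x - t + s) v) - ∫ v, f s (y - t + s) v) (Icc 0 T) s :=
    fun s hs => (h.hasDerivWithinAt_field hs _).sub (h.hasDerivWithinAt_field hs _)
  have := abs_sub_le_of_abs_deriv_le hu (β := fun s => 2 * V * (c * |x - y|) * s)
    (β' := fun _ => 2 * V * (c * |x - y|))
    (fun s => by simpa using (hasDerivAt_id s).const_mul (2 * V * (c * |x - y|)))
    (fun s hs => by
      rw [← MeasureTheory.integral_sub
        (integrable_of_support (h.density.continuous_velocity hs _) fun v hv => hsupp s hs _ v hv)
        (integrable_of_support (h.density.continuous_velocity hs _) fun v hv => hsupp s hs _ v hv)]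
      -- A velocity above V lies outside the support at both positions, so the difference of the two
      -- densities has the same velocity support bound.
      refine abs_integral_le_of_support hV (fun v hv => ?_) (fun v => ?_)
      · by_contra! hlt
        refine hv ?_
        have h0 : ∀ z, f s z v = 0 := fun z => by
          by_contra hne
          exact absurd (hsupp s hs z v hne) (not_le.2 hlt)
        rw [h0, h0, sub_zero]
      · have := hlip s hs (x - t + s) (y - t + s) v
        rwa [show x - t + s - (y - t + s) = x - y by ring] at this) ht
  simp only [sub_add_cancel, add_zero, h.init_field, mul_zero, sub_zero] at this
  have h2 := abs_sub_abs_le_abs_sub (B t x - B t y) (B₀ (x - t) - B₀ (y - t))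
  linarith

/-- All quantities on which the local existence time depends are bounded uniformly up to S, so
restarting close enough to S gives a solution beyond S, contradicting the definition of the
lifespan. -/
theorem IsMaximalSolution.false_of_gradient_bound (hf₀ : ContDiff ℝ 1 f₀)
    (hf₀c : HasCompactSupport f₀) {b : ℝ} (hb : ∀ x, |B₀ x| ≤ b)
    (hmax : IsMaximalSolution f₀ B₀ f B) {S t₁ c : ℝ} (hS : lifespan f₀ B₀ = ENNReal.ofReal S)
    (ht₁ : 0 ≤ t₁) (ht₁S : t₁ < S) (hc : 0 ≤ c)
    (hgrad : ∀ t ∈ Ioo t₁ S, ∀ x v,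
      |deriv (fun y => f t y v) x| ≤ c ∧ |deriv (fun w => f t x w) v| ≤ c) : False := by
  have hS0 : 0 < S := ht₁.trans_lt ht₁S
  have hsol : ∀ T, 0 < T → T < S → IsClassicalSolution f₀ B₀ T f B := fun T hT hTS =>
    hmax T hT (by rw [hS]; exact (ENNReal.ofReal_lt_ofReal_iff hS0).2 hTS)
  obtain ⟨P₀, hP₀⟩ := hf₀c.isCompact.isBounded.exists_norm_le
  obtain ⟨M, hM⟩ := hf₀c.exists_bound_of_continuous hf₀.continuous
  have hM0 : 0 ≤ M := (norm_nonneg _).trans (hM 0)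
  have hb0 : 0 ≤ b := (abs_nonneg _).trans (hb 0)
  set X := max P₀ 0 with hX
  have hX0 : 0 ≤ X := le_max_right _ _
  have hs₀ : ∀ x v, f₀ (x, v) ≠ 0 → |x| ≤ X ∧ |v| ≤ X := fun x v hne => by
    have := norm_prod_le_iff.1 (hP₀ _ (subset_tsupport _ hne))
    exact ⟨this.1.trans (le_max_left _ _), this.2.trans (le_max_left _ _)⟩
  set V := 2 * (X + b * S) * Real.exp ((4 * M + 1) * S) with hV
  have hV0 : 0 ≤ V := by positivity
  -- uniform bounds up to the time `S`
  have hvel : ∀ T, 0 < T → T < S → ∀ t ∈ Icc 0 T, ∀ x v, f t x v ≠ 0 → |v| ≤ V := by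
    intro T hT hTS t ht x v hne
    refine ((hsol T hT hTS).abs_velocity_le hM hX0 (fun x v h => (hs₀ x v h).2) hb t ht x v
      hne).trans ?_
    rw [hV]
    gcongr
  have hpos : ∀ T, 0 < T → T < S → ∀ t ∈ Icc 0 T, ∀ x v, f t x v ≠ 0 → |x| ≤ X + V * S := by
    intro T hT hTS t ht x v hne
    refine ((hsol T hT hTS).abs_position_le ⟨M, hM⟩ (fun x v h => (hs₀ x v h).1)
      (hvel T hT hTS) t ht x v hne).trans ?_
    have := ht.2.trans hTS.le
    gcongr
  have hfield : ∀ T, 0 < T → T < S → ∀ t ∈ Icc 0 T, ∀ x, |B t x| ≤ b + 2 * V * M * S := by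
    intro T hT hTS t ht x
    have h1 := (hsol T hT hTS).abs_field_sub_le (β := fun s => 2 * V * M * s)
      (β' := fun _ => 2 * V * M)
      (fun s => by simpa using (hasDerivAt_id s).const_mul (2 * V * M))
      (fun s hs x => abs_integral_le_of_support hV0 (fun v hv => hvel T hT hTS s hs x v hv)
        (fun v => (hsol T hT hTS).abs_density_le hM s hs x v)) t ht x
    have h2 := abs_sub_abs_le_abs_sub (B t x) (B₀ (x - t))
    have h3 : 2 * V * M * t ≤ 2 * V * M * S := by
      have := ht.2.trans hTS.le
      gcongr
    linarith [hb (x - t)]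
  -- The gradient bound is only known after t₁, so the growth of ∂ₓB is measured from a fixed
  -- intermediate time t₂, at which B is C¹ and hence locally Lipschitz.
  obtain ⟨t₂, ht₁₂, ht₂S⟩ := exists_between ht₁S
  have ht₂0 : 0 < t₂ := ht₁.trans_lt ht₁₂
  set R := X + V * S + V with hR
  have hR0 : 0 ≤ R := by positivity
  have hBt₂ : ContDiff ℝ 1 (B t₂) := (hsol t₂ ht₂0 ht₂S).field.contDiff_slice ⟨ht₂0.le, le_rfl⟩
  -- Local existence asks for ∂ₓB on |x| ≤ R + 3. One more unit leaves room for difference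
  -- quotients, and S for following lines of speed one back to time t₂.
  obtain ⟨K, hK0, hK⟩ := exists_abs_sub_le_of_contDiff hBt₂ (R + 4 + S)
  -- The terms bound, in this order, the density, its Lipschitz constant (c for each variable), the
  -- field, and the local Lipschitz constant of the field at times after t₂. None depends on the
  -- restart time, hence neither does δ.
  set A := M + 2 * c + (b + 2 * V * M * S) + (K + 2 * V * c * S) with hA
  have hA0 : 0 ≤ A := by positivity
  have hA1 : M ≤ A := by have : 0 ≤ 2 * c + (b + 2 * V * M * S) + (K + 2 * V * c * S) := by positivity
                         linarith
  have hA2 : 2 * c ≤ A := by have : 0 ≤ M + (b + 2 * V * M * S) + (K + 2 * V * c * S) := by positivity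
                             linarith
  have hA3 : b + 2 * V * M * S ≤ A := by have : 0 ≤ M + 2 * c + (K + 2 * V * c * S) := by positivity
                                         linarith
  have hA4 : K + 2 * V * c * S ≤ A := by
    have : 0 ≤ M + 2 * c + (b + 2 * V * M * S) := by positivity
    linarith
  obtain ⟨δ, hδ, H⟩ := exists_solution_of_bounds hR0 hA0
  -- restart at a time closer to `S` than `δ`
  obtain ⟨t₀, ht₀, ht₀S⟩ := exists_between (max_lt ht₂S (by linarith : S - δ < S))
  have ht₂₀ : t₂ < t₀ := (le_max_left _ _).trans_lt ht₀
  have ht₀δ : S < t₀ + δ := by linarith [(le_max_right t₂ (S - δ)).trans_lt ht₀]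
  have ht₀0 : 0 < t₀ := ht₂0.trans ht₂₀
  have hmem : t₀ ∈ Icc 0 t₀ := ⟨ht₀0.le, le_rfl⟩
  have h₀ := hsol t₀ ht₀0 ht₀S
  have hincr : ∀ x y, |B t₀ x - B t₀ y| ≤
      |B t₂ (x - (t₀ - t₂)) - B t₂ (y - (t₀ - t₂))| + 2 * V * (c * |x - y|) * (t₀ - t₂) := by
    intro x y
    have hsh : ∀ t ∈ Icc 0 (t₀ - t₂), t₂ + t ∈ Icc 0 t₀ := fun t ht =>
      ⟨by linarith [ht.1], by linarith [ht.2]⟩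
    have := (h₀.shift ht₂0.le ht₂₀).abs_field_increment_le (c := c) hV0
      (fun t ht x v => hvel t₀ ht₀0 ht₀S _ (hsh t ht) x v)
      (fun t ht x y v => by
        have := h₀.density.abs_increment_le (hsh t ht) (hgrad (t₂ + t)
          ⟨by linarith [ht.1], by linarith [ht.2]⟩) x v y v
        simpa using this) (t := t₀ - t₂) ⟨by linarith, le_rfl⟩ x y
    rwa [add_sub_cancel] at this
  have hlipB : ∀ x y, |x| ≤ R + 4 → |y| ≤ R + 4 → |B t₀ x - B t₀ y| ≤ A * |x - y| := by
    intro x y hx hy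
    have hτ : |t₀ - t₂| ≤ S := by rw [abs_of_pos (by linarith)]; linarith
    have h1 := hK (x - (t₀ - t₂)) (y - (t₀ - t₂)) ((abs_sub _ _).trans (by linarith))
      ((abs_sub _ _).trans (by linarith))
    rw [sub_sub_sub_cancel_right] at h1
    have h2 : 2 * V * (c * |x - y|) * (t₀ - t₂) ≤ 2 * V * (c * |x - y|) * S := by
      gcongr; linarith
    calc _ ≤ K * |x - y| + 2 * V * (c * |x - y|) * S := (hincr x y).trans (by linarith)
      _ = (K + 2 * V * c * S) * |x - y| := by ring
      _ ≤ A * |x - y| := by gcongr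
  obtain ⟨g, D, hgD⟩ := H (fun z => f t₀ z.1 z.2) (B t₀) (h₀.density.contDiff_slice hmem)
    (h₀.field.contDiff_slice hmem)
    (fun x v hne => ⟨(hpos t₀ ht₀0 ht₀S t₀ hmem x v hne).trans (by linarith),
      (hvel t₀ ht₀0 ht₀S t₀ hmem x v hne).trans (by
        have : 0 ≤ X + V * S := by positivity
        linarith)⟩)
    (fun z => (h₀.abs_density_le hM t₀ hmem z.1 z.2).trans hA1)
    (fun z z' => by
      refine (h₀.density.abs_increment_le hmem (hgrad t₀ ⟨by linarith, ht₀S⟩) _ _ _ _).trans ?_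
      have h1 : |z.1 - z'.1| ≤ ‖z - z'‖ := norm_fst_le (z - z')
      have h2 : |z.2 - z'.2| ≤ ‖z - z'‖ := norm_snd_le (z - z')
      calc _ ≤ c * ‖z - z'‖ + c * ‖z - z'‖ := by gcongr
        _ = 2 * c * ‖z - z'‖ := by ring
        _ ≤ A * ‖z - z'‖ := by gcongr)
    (fun x hx => ⟨(hfield t₀ ht₀0 ht₀S t₀ hmem x).trans hA3, by
      refine norm_deriv_le_of_lip' (f := B t₀) hA0 ?_
      filter_upwards [Metric.closedBall_mem_nhds x one_pos] with y hy
      rw [Metric.mem_closedBall, Real.dist_eq] at hy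
      exact hlipB y x (by linarith [abs_sub_abs_le_abs_sub y x]) (by linarith)⟩)
  obtain ⟨T, ht₀T, hTS⟩ := exists_between ht₀S
  obtain ⟨F, C, hFC⟩ := (hsol T (ht₀0.trans ht₀T) hTS).extend ht₀0.le ht₀T hgD (by linarith)
  have := hFC.le_lifespan
  rw [hS, ENNReal.ofReal_le_ofReal_iff hS0.le] at this
  linarith

theorem IsMaximalSolution.limsup_gradientNorm_eq_top (hf₀ : ContDiff ℝ 1 f₀)
    (hf₀c : HasCompactSupport f₀) (hB₀ : ContDiff ℝ 1 B₀) {b : ℝ} (hb : ∀ x, |B₀ x| ≤ b)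
    (hmax : IsMaximalSolution f₀ B₀ f B) (hfin : lifespan f₀ B₀ ≠ ⊤) :
    limsup (fun t => gradientNorm f t)
      (𝓝[<] (lifespan f₀ B₀).toReal) = ⊤ := by
  by_contra hne
  obtain ⟨c, hc, hc'⟩ := ENNReal.lt_iff_exists_nnreal_btwn.1 (lt_top_iff_ne_top.2 hne)
  have hev := eventually_lt_of_limsup_lt hc
  set S := (lifespan f₀ B₀).toReal with hS
  have hS' : lifespan f₀ B₀ = ENNReal.ofReal S := (ENNReal.ofReal_toReal hfin).symm
  -- Local existence makes the lifespan positive, so a left neighbourhood of it contains an interval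
  -- starting at a nonnegative time.
  have hS0 : 0 < S := by
    obtain ⟨T, f', B', h⟩ := exists_classicalSolution hf₀ hf₀c hB₀
    have := h.le_lifespan
    rw [hS'] at this
    by_contra! hle
    rw [ENNReal.ofReal_of_nonpos hle] at this
    exact absurd h.pos (not_lt.2 (ENNReal.ofReal_eq_zero.1 (le_zero_iff.1 this)))
  obtain ⟨t₁, ht₁, hsub⟩ := (mem_nhdsLT_iff_exists_mem_Ico_Ioo_subset hS0).1 hev
  refine hmax.false_of_gradient_bound hf₀ hf₀c hb hS' ht₁.1 ht₁.2 c.2 fun t ht x v => ?_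
  have hlt : gradientNorm f t < c := hsub ht
  have hnn : ∀ d : ℝ, ‖d‖ₑ ≤ gradientNorm f t → |d| ≤ c := by
    intro d hd
    have h1 : ‖d‖ₑ ≤ (c : ℝ≥0∞) := hd.trans hlt.le
    rw [enorm_le_coe] at h1
    exact h1
  refine ⟨hnn _ (le_add_right ?_), hnn _ (le_add_left ?_)⟩
  · exact le_iSup₂ (f := fun x v => ‖deriv (fun y => f t y v) x‖ₑ) x v
  · exact le_iSup₂ (f := fun x v => ‖deriv (fun w => f t x w) v‖ₑ) x v

end Continuation

end VlasovField

theorem theorem3p1 (f₀ : ℝ × ℝ → ℝ) (B₀ : ℝ → ℝ)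
    (hf₀ : ContDiff ℝ 1 f₀) (hf₀c : HasCompactSupport f₀) (hB₀ : ContDiff ℝ 1 B₀) :
    -- local existence
    (∃ T : ℝ, ∃ f B, VlasovField.IsClassicalSolution f₀ B₀ T f B) ∧
    -- uniqueness, on every time interval
    (∀ (T : ℝ) (f g : ℝ → ℝ → ℝ → ℝ) (B D : ℝ → ℝ → ℝ),
      VlasovField.IsClassicalSolution f₀ B₀ T f B →
      VlasovField.IsClassicalSolution f₀ B₀ T g D →
      ∀ t ∈ Set.Icc 0 T, ∀ x : ℝ, (∀ v : ℝ, f t x v = g t x v) ∧ B t x = D t x) ∧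
    -- the solution exists on the whole of `[0, T*)`
    (∃ f B, VlasovField.IsMaximalSolution f₀ B₀ f B) ∧
    -- blow-up of the gradient at a finite `T*`, for bounded initial field
    ((∃ C : ℝ, ∀ x : ℝ, |B₀ x| ≤ C) → VlasovField.lifespan f₀ B₀ ≠ ⊤ →
      ∀ f B, VlasovField.IsMaximalSolution f₀ B₀ f B →
        Filter.limsup (fun t => VlasovField.gradientNorm f t)
          (nhdsWithin (VlasovField.lifespan f₀ B₀).toReal
            (Set.Iio (VlasovField.lifespan f₀ B₀).toReal)) = ⊤) :=
  ⟨VlasovField.exists_classicalSolution hf₀ hf₀c hB₀,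
    fun _ _ _ _ _ h h' => h.eq_of_eq_data h',
    VlasovField.exists_isMaximalSolution f₀ B₀,
    fun ⟨_, hb⟩ hfin _ _ hmax => hmax.limsup_gradientNorm_eq_top hf₀ hf₀c hB₀ hb hfin⟩
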